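/- Let $\mathbb B^2=\{z\in\mathbb C^2:\|z\|<1\}$ be the open unit ball, $\triangle$ the open unit disc in $\mathbb C$, and $\mathrm{Aut_{hol}}(\mathbb B^2)$ the group of biholomorphic self-maps of $\mathbb B^2$. A subgroup $\Gamma\subset\mathrm{Aut_{hol}}(\mathbb B^2)$ is called a Kleinian group if every point $z\in\mathbb B^2$ has an open neighbourhood $U$ such that, for $\phi\in\Gamma$, $\phi(U)\cap U\neq\emptyset$ implies $\phi=\mathrm{id}$; the quotient $\mathbb B^2/\Gamma$ is then a complex manifold. For a complex manifold $X$ and a point $(x,v)\in TX$ the Kobayashi metric is $$\omega_K^X(x,v)=\inf\Big\{\frac1\lambda : \lambda>0,\ f:\triangle\to X \text{ holomorphic},\ f(0)=x,\ df(0)(1)=\lambda v\Big\},$$ and the injective Kobayashi metric $\omega_\iota^X(x,v)$ is the infimum over the same set with $f$ in addition required to be injective. Theorem. Let $\Gamma\subset\mathrm{Aut_{hol}}(\mathbb B^2)$ be a Kleinian group, set $X:=\mathbb B^2/\Gamma$, and assume that $X$ is compact. Then $\omega_K^X\neq\omega_\iota^X$, that is, the two functions differ at some point of $TX$. -/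

import Mathlib

open scoped Manifold ContDiff ENNReal Topology

noncomputable section

namespace BallQuotients

/-! ### The Kobayashi metric and the injective Kobayashi metric of a complex manifold -/

section Kobayashi

variable (E : Type*) [NormedAddCommGroup E] [NormedSpace ℂ E]
  (X : Type*) [TopologicalSpace X] [ChartedSpace E X]

/-- `IsHolDiscAlong E X f p r` says that `f` restricts to a holomorphic map from the open unit disc
to `X` with `f(0) = x` and `df(0)(1) = r v`, where `p = (x, v) ∈ TX`. (The values of `f` outside
the unit disc play no role.) -/
def IsHolDiscAlong (f : ℂ → X) (p : TangentBundle 𝓘(ℂ, E) X) (r : ℝ) : Prop :=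
  ContMDiffOn 𝓘(ℂ, ℂ) 𝓘(ℂ, E) ω f (Metric.ball (0 : ℂ) 1) ∧
    tangentMap 𝓘(ℂ, ℂ) 𝓘(ℂ, E) f ⟨0, (1 : ℂ)⟩ = ⟨p.proj, (r : ℂ) • p.snd⟩

/-- The infinitesimal Kobayashi metric `ω_K` of `X`, as a function on the tangent bundle: the
infimum of `1 / r` over all `r > 0` and all holomorphic maps `f : Δ → X` with `f(0) = x` and
`df(0)(1) = r v`. -/
def kobayashiMetric (p : TangentBundle 𝓘(ℂ, E) X) : ℝ≥0∞ :=
  sInf {t | ∃ (f : ℂ → X) (r : ℝ), 0 < r ∧ IsHolDiscAlong E X f p r ∧ t = ENNReal.ofReal (1 / r)}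

/-- The injective Kobayashi metric `ω_ι` of `X`: the same infimum, taken only over the
holomorphic maps `f : Δ → X` that are injective on the unit disc `Δ`. -/
def injectiveKobayashiMetric (p : TangentBundle 𝓘(ℂ, E) X) : ℝ≥0∞ :=
  sInf {t | ∃ (f : ℂ → X) (r : ℝ), 0 < r ∧ IsHolDiscAlong E X f p r ∧
    Set.InjOn f (Metric.ball (0 : ℂ) 1) ∧ t = ENNReal.ofReal (1 / r)}

end Kobayashi

/-! ### The unit ball of `ℂ²`, its automorphisms, and Kleinian groups -/

/-- `ℂ²` with its Euclidean norm. -/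
abbrev C2 : Type := EuclideanSpace ℂ (Fin 2)

/-- The open unit ball `𝔹²` of `ℂ²`, as an open subset (hence a complex manifold). -/
def unitBall : TopologicalSpace.Opens C2 := ⟨Metric.ball 0 1, Metric.isOpen_ball⟩

/-- The group of biholomorphic self-maps of `𝔹²`. -/
def holAut : Subgroup (Equiv.Perm unitBall) where
  carrier := {φ | ContMDiff 𝓘(ℂ, C2) 𝓘(ℂ, C2) ω (φ : unitBall → unitBall) ∧
    ContMDiff 𝓘(ℂ, C2) 𝓘(ℂ, C2) ω (φ.symm : unitBall → unitBall)}
  mul_mem' ha hb := ⟨ha.1.comp hb.1, hb.2.comp ha.2⟩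
  one_mem' := ⟨contMDiff_id, contMDiff_id⟩
  inv_mem' ha := ⟨ha.2, ha.1⟩

/-- A subgroup `Γ` of the automorphism group of `𝔹²` is Kleinian if every point `z` of the ball has
an open neighbourhood `U` such that `φ(U) ∩ U ≠ ∅` with `φ ∈ Γ` forces `φ = id`. -/
class IsKleinian (Γ : Subgroup holAut) : Prop where
  exists_nhd : ∀ z : unitBall, ∃ U : Set unitBall, IsOpen U ∧ z ∈ U ∧
    ∀ φ ∈ Γ, ((fun y => φ • y) '' U ∩ U).Nonempty → φ = 1

/-! ### The quotient `X = 𝔹² / Γ` as a complex manifold -/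

/-- The orbit space `𝔹² / Γ`. -/
def BallQuotient (Γ : Subgroup holAut) : Type := MulAction.orbitRel.Quotient Γ unitBall

namespace BallQuotient

variable (Γ : Subgroup holAut)

/-- The quotient topology. -/
instance : TopologicalSpace (BallQuotient Γ) :=
  inferInstanceAs (TopologicalSpace (Quotient (MulAction.orbitRel Γ unitBall)))

/-- The projection `π : 𝔹² → 𝔹² / Γ`. -/
def proj : unitBall → BallQuotient Γ := Quotient.mk (MulAction.orbitRel Γ unitBall)

theorem proj_eq_iff {y z : unitBall} : proj Γ y = proj Γ z ↔ ∃ φ : Γ, φ • z = y :=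
  Quotient.eq

theorem proj_surjective : Function.Surjective (proj Γ) := Quotient.mk_surjective

theorem contMDiff_smul (φ : Γ) : ContMDiff 𝓘(ℂ, C2) 𝓘(ℂ, C2) ω (fun z : unitBall => φ • z) :=
  φ.1.2.1

theorem isLocalHomeomorph_proj [h : IsKleinian Γ] : IsLocalHomeomorph (proj Γ) := by
  have hq : IsQuotientCoveringMap (proj Γ) Γ :=
    { toIsQuotientMap := isQuotientMap_quotient_mk'
      toContinuousConstSMul := ⟨fun φ => (contMDiff_smul Γ φ).continuous⟩
      apply_eq_iff_mem_orbit := Quotient.eq''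
      disjoint := fun z => by
        obtain ⟨U, hU, hz, H⟩ := h.exists_nhd z
        exact ⟨U, hU.mem_nhds hz, fun φ hφ => Subtype.ext (H φ.1 φ.2 hφ)⟩ }
  exact hq.isCoveringMap.isLocalHomeomorph

/-- The charts of `𝔹² / Γ` are the local inverses of the projection `𝔹² → 𝔹² / Γ`, followed by the
inclusion of the ball in `ℂ²`. -/
instance [IsKleinian Γ] : ChartedSpace C2 (BallQuotient Γ) :=
  (isLocalHomeomorph_proj Γ).chartedSpace (proj_surjective Γ)

/-- Transition maps between charts are locally given by elements of `Γ`, so that `𝔹² / Γ` is a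
complex manifold. -/
instance [IsKleinian Γ] : IsManifold 𝓘(ℂ, C2) ω (BallQuotient Γ) := by
  have hl := isLocalHomeomorph_proj Γ
  apply isManifold_of_contDiffOn
  rintro _ _ ⟨p, rfl⟩ ⟨q, rfl⟩
  set a := (proj_surjective Γ).hasRightInverse.choose p
  set b := (proj_surjective Γ).hasRightInverse.choose q
  intro x hx
  set c := chartAt C2 a with hc
  set d := chartAt C2 b with hd
  obtain ⟨hx1, -⟩ := hx
  simp only [modelWithCornersSelf_coe_symm, Set.preimage_id,
    OpenPartialHomeomorph.trans_source, OpenPartialHomeomorph.symm_source,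
    OpenPartialHomeomorph.trans_symm_eq_symm_trans_symm,
    OpenPartialHomeomorph.coe_trans, Set.mem_inter_iff, Set.mem_preimage, Function.comp_apply,
    IsLocalHomeomorph.localInverseAt_symm] at hx1
  obtain ⟨⟨hxc, hxa⟩, hxb, hxd⟩ := hx1
  set y := c.symm x with hy
  set y' := hl.localInverseAt b (proj Γ y) with hy'
  have hyy' : proj Γ y' = proj Γ y := hl.apply_localInverseAt_of_mem hxb
  obtain ⟨φ, hφ⟩ := (proj_eq_iff Γ).1 hyy'
  have hcont : ContinuousAt c.symm x := c.continuousAt_symm hxc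
  have key : ∀ᶠ z in 𝓝 y, hl.localInverseAt b (proj Γ z) = φ • z := by
    have h1 : ∀ᶠ z in 𝓝 y, φ • z ∈ (hl.localInverseAt b).target := by
      refine (contMDiff_smul Γ φ).continuous.continuousAt.eventually_mem
        ((hl.localInverseAt b).open_target.mem_nhds ?_)
      rw [hφ]
      exact (hl.localInverseAt b).map_source hxb
    have h2 : ∀ᶠ z in 𝓝 y, proj Γ z ∈ (hl.localInverseAt b).source :=
      hl.continuous.continuousAt.eventually_mem ((hl.localInverseAt b).open_source.mem_nhds hxb)
    filter_upwards [h1, h2] with z hz1 hz2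
    refine hl.injOn_localInverseAt_target ((hl.localInverseAt b).map_source hz2) hz1 ?_
    rw [hl.apply_localInverseAt_of_mem hz2]
    exact (proj_eq_iff Γ).2 ⟨φ⁻¹, inv_smul_smul φ z⟩
  have hsm : ContMDiffAt 𝓘(ℂ, C2) 𝓘(ℂ, C2) ω (fun w => d (φ • c.symm w)) x := by
    have h1 : ContMDiffAt 𝓘(ℂ, C2) 𝓘(ℂ, C2) ω c.symm x :=
      contMDiffOn_chart_symm.contMDiffAt (c.open_target.mem_nhds hxc)
    have h2 : ContMDiffAt 𝓘(ℂ, C2) 𝓘(ℂ, C2) ω d (φ • c.symm x) := by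
      rw [← hy, hφ]
      exact contMDiffOn_chart.contMDiffAt (d.open_source.mem_nhds hxd)
    exact h2.comp x (((contMDiff_smul Γ φ) _).comp x h1)
  refine (contMDiffAt_iff_contDiffAt.1 hsm |>.congr_of_eventuallyEq ?_).contDiffWithinAt
  filter_upwards [hcont.eventually key] with w hw
  change d (hl.localInverseAt b ((hl.localInverseAt a).symm (c.symm w))) = _
  rw [hl.localInverseAt_symm, hw]

end BallQuotient

end BallQuotients

end

/-!
The proof compares extremal discs with their perturbations. Let `L` be a complex line meeting the
ball, and `c` the midpoint of the affine disc `L ∩ 𝔹²`. This affine disc is extremal for the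
Kobayashi metric at `c` in the direction of `L`, and every disc which is almost extremal there is
uniformly close to it on smaller discs (`exists_close_of_almost_extremal`). The discs of the
quotient lift to the ball, so if the two metrics agree, then injective discs of the quotient lift
to discs arbitrarily close to `L ∩ 𝔹²`. But if some `φ ∈ Γ` maps a point of `L ∩ 𝔹²` to a point of
`L ∩ 𝔹²` in such a way that `φ(L)` and `L` are transversal there, then this crossing in complex
dimension two is stable under perturbation (`exists_crossing_of_close`), and the nearby discs
cannot be injective in the quotient, as `Γ` acts freely.

It remains to find such `φ` and `L`. Automorphisms of the ball are induced by linear isometries `A`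
of the Hermitian form of signature `(2, 1)` on `ℂ × ℂ²` (`exists_isLift`), and the line through `z`
and `φ z` works as soon as `z` represents a cyclic vector of `A` (`transversal_of_cyclic`).
Compactness provides a nontrivial `φ`. It has no fixed point in the ball, hence `A` has a null
eigenvector. If its eigenvalue had absolute value `1`, then `φ` would move some points by
arbitrarily small hyperbolic distances, which compactness of the quotient excludes
(`exists_forall_not_isHypClose`). So `φ` is loxodromic, `A` has three distinct eigenvalues, and it
has a cyclic vector in the negative cone (`IsFormIsometry.exists_cyclic`).
-/

noncomputable section

namespace BallQuotients

open ComplexConjugate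

/-! ### Isometries of the Hermitian form of signature `(2, 1)` -/

/-- The Hermitian form `⟪x₂, y₂⟫ - conj x₁ * y₁` of signature `(2, 1)` on `ℂ × ℂ²`, conjugate linear
in the first argument. The ball is the set of lines on which it is negative: `z ∈ 𝔹²` corresponds
to the line spanned by `(1, z)`. -/
def form : (ℂ × C2) →ₗ⋆[ℂ] (ℂ × C2) →ₗ[ℂ] ℂ :=
  LinearMap.mk₂'ₛₗ (starRingEnd ℂ) (RingHom.id ℂ)
    (fun x y => inner ℂ x.2 y.2 - conj x.1 * y.1)
    (fun x x' y => by simp; ring)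
    (fun c x y => by simp; ring)
    (fun x y y' => by simp; ring)
    (fun c x y => by simp; ring)

/-- The quadratic form `x ↦ form x x`, as a real number. -/
def quad (x : ℂ × C2) : ℝ := ‖x.2‖ ^ 2 - ‖x.1‖ ^ 2

theorem form_apply (x y : ℂ × C2) : form x y = inner ℂ x.2 y.2 - conj x.1 * y.1 := rfl

theorem conj_form (x y : ℂ × C2) : conj (form x y) = form y x := by
  simp [form_apply, mul_comm]

theorem form_eq_zero_symm {x y : ℂ × C2} (h : form x y = 0) : form y x = 0 := by
  rw [← conj_form, h, map_zero]

theorem form_self (x : ℂ × C2) : form x x = (quad x : ℂ) := by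
  rw [form_apply, inner_self_eq_norm_sq_to_K, mul_comm, Complex.mul_conj, quad,
    Complex.normSq_eq_norm_sq]
  push_cast
  rfl

theorem quad_eq_of_form {x : ℂ × C2} {r : ℝ} (h : form x x = r) : quad x = r := by
  rw [form_self] at h
  exact_mod_cast h

theorem quad_smul (c : ℂ) (x : ℂ × C2) : quad (c • x) = ‖c‖ ^ 2 * quad x := by
  simp [quad, norm_smul]
  ring

/-- The origin of the ball, in homogeneous coordinates. -/
def originVec : ℂ × C2 := (1, 0)

theorem quad_originVec : quad originVec = -1 := by simp [quad, originVec]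

theorem quad_pos_of_orthogonal {x w : ℂ × C2} (hx : quad x < 0) (h : form x w = 0) (hw : w ≠ 0) :
    0 < quad w := by
  have h1 : ‖x.1‖ * ‖w.1‖ ≤ ‖x.2‖ * ‖w.2‖ := by
    have h2 : conj x.1 * w.1 = inner ℂ x.2 w.2 := by
      rw [form_apply, sub_eq_zero] at h
      exact h.symm
    calc ‖x.1‖ * ‖w.1‖ = ‖conj x.1 * w.1‖ := by simp
      _ ≤ _ := by rw [h2]; exact norm_inner_le_norm _ _
  have h3 : ‖x.2‖ < ‖x.1‖ := by
    have : ‖x.2‖ ^ 2 < ‖x.1‖ ^ 2 := by unfold quad at hx; linarith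
    exact lt_of_pow_lt_pow_left₀ 2 (norm_nonneg _) this
  have h0 : 0 < ‖x.1‖ := (norm_nonneg _).trans_lt h3
  have h4 : w.2 ≠ 0 := by
    intro h5
    rw [h5, norm_zero, mul_zero] at h1
    have h6 : ‖w.1‖ ≤ 0 := by
      by_contra hc
      push Not at hc
      nlinarith [mul_pos h0 hc]
    exact hw (Prod.ext (norm_le_zero_iff.1 h6) h5)
  have h5 : 0 < ‖w.2‖ := norm_pos_iff.2 h4
  have h6 : ‖w.1‖ < ‖w.2‖ := by
    by_contra hc
    push Not at hc
    have := mul_lt_mul_of_pos_right h3 h5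
    have := mul_le_mul_of_nonneg_left hc h0.le
    linarith
  unfold quad
  nlinarith [norm_nonneg w.1]

/-- Two orthogonal null vectors are proportional. -/
theorem exists_smul_of_null {n m : ℂ × C2} (hn : quad n = 0) (hm : quad m = 0)
    (h : form n m = 0) (h0 : n ≠ 0) : ∃ c : ℂ, m = c • n := by
  have hn1 : n.1 ≠ 0 := by
    intro h1
    apply h0
    have : ‖n.2‖ = 0 := by
      simpa [quad, h1] using hn
    exact Prod.ext h1 (norm_eq_zero.1 this)
  set v := n.1 • m - m.1 • n with hv
  have hv1 : v.1 = 0 := by simp [hv, mul_comm]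
  have hq : quad v = 0 := by
    apply quad_eq_of_form
    simp [hv, form_self, hn, hm, h, form_eq_zero_symm h]
  have hv2 : v.2 = 0 := by simpa [quad, hv1] using hq
  have hv0 : v = 0 := Prod.ext hv1 hv2
  refine ⟨m.1 / n.1, ?_⟩
  rw [hv, sub_eq_zero] at hv0
  rw [div_eq_inv_mul, mul_smul, ← hv0, smul_smul, inv_mul_cancel₀ hn1, one_smul]

theorem exists_eigenvector_mem (A : (ℂ × C2) →ₗ[ℂ] (ℂ × C2)) (W : Submodule ℂ (ℂ × C2))
    (hW : ∀ x ∈ W, A x ∈ W) (h0 : W ≠ ⊥) : ∃ e ∈ W, e ≠ 0 ∧ ∃ μ : ℂ, A e = μ • e := by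
  have : Nontrivial W := Submodule.nontrivial_iff_ne_bot.2 h0
  obtain ⟨μ, hμ⟩ := Module.End.exists_eigenvalue (A.restrict hW)
  obtain ⟨e, he⟩ := hμ.exists_hasEigenvector
  refine ⟨e, e.2, fun h => he.2 (Subtype.ext h), μ, ?_⟩
  have := congrArg Subtype.val he.apply_eq_smul
  simpa using this

theorem finrank_C2 : Module.finrank ℂ C2 = 2 := by simp [C2]

theorem finrank_prod : Module.finrank ℂ (ℂ × C2) = 3 := by
  rw [Module.finrank_prod, finrank_C2]
  simp

theorem orthogonal_inf_orthogonal_ne_bot (e f : ℂ × C2) : (form e).ker ⊓ (form f).ker ≠ ⊥ := by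
  have h := LinearMap.ker_ne_bot_of_finrank_lt (f := (form e).prod (form f)) (by
    rw [finrank_prod]; simp)
  rwa [LinearMap.ker_prod] at h

/-- The form is positive definite on subspaces of dimension at most `2` only. -/
theorem not_three_orthogonal_pos {e f g : ℂ × C2} (he : 0 < quad e) (hf : 0 < quad f)
    (hg : 0 < quad g) (hef : form e f = 0) (heg : form e g = 0) (hfg : form f g = 0) : False := by
  set T : (Fin 3 → ℂ) →ₗ[ℂ] C2 :=
    (LinearMap.snd ℂ ℂ C2) ∘ₗ (Fintype.linearCombination ℂ ![e, f, g]) with hT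
  have hk := LinearMap.ker_ne_bot_of_finrank_lt (f := T) (by rw [finrank_C2]; simp)
  obtain ⟨a, ha, ha0⟩ := Submodule.exists_mem_ne_zero_of_ne_bot hk
  set v := a 0 • e + a 1 • f + a 2 • g with hv
  have hv2 : v.2 = 0 := by
    have : T a = 0 := ha
    simpa [hT, Fintype.linearCombination_apply, Fin.sum_univ_three, hv] using this
  have hq : quad v = ‖a 0‖ ^ 2 * quad e + ‖a 1‖ ^ 2 * quad f + ‖a 2‖ ^ 2 * quad g := by
    apply quad_eq_of_form
    have key : ∀ c : ℂ, c * conj c = (‖c‖ : ℂ) ^ 2 := fun c => Complex.mul_conj' c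
    simp only [hv, map_add, LinearMap.add_apply, map_smulₛₗ, LinearMap.smul_apply, hef, heg, hfg,
      form_eq_zero_symm hef, form_eq_zero_symm heg, form_eq_zero_symm hfg, form_self, smul_eq_mul,
      RingHom.id_apply]
    push_cast
    rw [← key, ← key, ← key]
    ring
  have hneg : quad v ≤ 0 := by
    simp [quad, hv2]
  have h0 : ‖a 0‖ ^ 2 * quad e = 0 ∧ ‖a 1‖ ^ 2 * quad f = 0 ∧ ‖a 2‖ ^ 2 * quad g = 0 := by
    have h1 := mul_nonneg (sq_nonneg ‖a 0‖) he.le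
    have h2 := mul_nonneg (sq_nonneg ‖a 1‖) hf.le
    have h3 := mul_nonneg (sq_nonneg ‖a 2‖) hg.le
    refine ⟨?_, ?_, ?_⟩ <;> linarith
  apply ha0
  ext i
  fin_cases i
  · simpa [he.ne'] using h0.1
  · simpa [hf.ne'] using h0.2.1
  · simpa [hg.ne'] using h0.2.2

/-- A linear map of `ℂ × ℂ²` preserving the Hermitian form. -/
def IsFormIsometry (A : (ℂ × C2) →ₗ[ℂ] (ℂ × C2)) : Prop := ∀ x y, form (A x) (A y) = form x y

section Isometry

variable {A : (ℂ × C2) →ₗ[ℂ] (ℂ × C2)}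

theorem IsFormIsometry.quad_eq (hA : IsFormIsometry A) (x : ℂ × C2) : quad (A x) = quad x := by
  apply quad_eq_of_form
  rw [hA, form_self]

theorem form_originVec_ne_zero {n : ℂ × C2} (hn : quad n = 0) (h0 : n ≠ 0) :
    form originVec n ≠ 0 := fun h =>
  (quad_pos_of_orthogonal (by rw [quad_originVec]; norm_num) h h0).ne' hn

theorem IsFormIsometry.eigenvalue_ne_zero (hA : IsFormIsometry A) {n : ℂ × C2} {β : ℂ}
    (hn : quad n = 0) (h0 : n ≠ 0) (h : A n = β • n) : β ≠ 0 := by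
  rintro rfl
  have := hA originVec n
  rw [h] at this
  simp only [zero_smul, map_zero] at this
  exact form_originVec_ne_zero hn h0 this.symm

theorem IsFormIsometry.orthogonal_invariant (hA : IsFormIsometry A) {e x : ℂ × C2} {α : ℂ}
    (he : quad e ≠ 0) (h : A e = α • e) (hx : form e x = 0) : form e (A x) = 0 := by
  have h1 := hA e x
  rw [h, hx] at h1
  have h2 := hA.quad_eq e
  rw [h, quad_smul] at h2
  have hα : α ≠ 0 := by
    rintro rfl
    simp at h2
    exact he h2.symm
  simpa [hα] using h1

/-- Since an isometry has an eigenvector in each nonzero invariant subspace and three pairwise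
orthogonal positive vectors do not exist, an isometry without negative eigenvector has a null
eigenvector. -/
theorem IsFormIsometry.exists_null_eigenvector (hA : IsFormIsometry A)
    (hneg : ∀ x, quad x < 0 → ∀ α : ℂ, A x ≠ α • x) :
    ∃ n, n ≠ 0 ∧ quad n = 0 ∧ ∃ β : ℂ, A n = β • n := by
  by_contra hc
  push Not at hc
  have pos : ∀ e, e ≠ 0 → ∀ μ : ℂ, A e = μ • e → 0 < quad e := by
    intro e he μ hμ
    rcases lt_trichotomy (quad e) 0 with h | h | h
    · exact (hneg e h μ hμ).elim
    · exact (hc e he h μ hμ).elim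
    · exact h
  obtain ⟨e, -, he0, α, he⟩ := exists_eigenvector_mem A ⊤ (by simp) (by
    intro h
    have : originVec ∈ (⊤ : Submodule ℂ (ℂ × C2)) := trivial
    rw [h, Submodule.mem_bot] at this
    simp [originVec, Prod.ext_iff] at this)
  have hqe := pos e he0 α he
  obtain ⟨f, hfm, hf0, μ, hf⟩ := exists_eigenvector_mem A (form e).ker
    (fun x hx => hA.orthogonal_invariant hqe.ne' he hx) (fun h =>
      orthogonal_inf_orthogonal_ne_bot e e (by rw [h]; simp))
  have hqf := pos f hf0 μ hf
  obtain ⟨g, hgm, hg0, ν, hg⟩ := exists_eigenvector_mem A ((form e).ker ⊓ (form f).ker)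
    (fun x hx => ⟨hA.orthogonal_invariant hqe.ne' he hx.1,
      hA.orthogonal_invariant hqf.ne' hf hx.2⟩) (orthogonal_inf_orthogonal_ne_bot e f)
  exact not_three_orthogonal_pos hqe hqf (pos g hg0 ν hg) hfm hgm.1 hgm.2

theorem IsFormIsometry.conj_mul_form (hA : IsFormIsometry A) {n : ℂ × C2} {β : ℂ}
    (h : A n = β • n) (x : ℂ × C2) : conj β * form n (A x) = form n x := by
  have h1 := hA n x
  rw [h] at h1
  simpa using h1

/-- A null vector can be scaled to have product `-1` with a vector not orthogonal to it. -/
theorem exists_smul_form_eq_neg_one {x n : ℂ × C2} (h : form x n ≠ 0) :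
    form x ((-(form x n)⁻¹) • n) = -1 := by
  simp [h]

/-- If a null eigenvector has an eigenvalue of absolute value `1`, then the isometry moves the
points on a ray towards the null vector by arbitrarily small hyperbolic distances. -/
theorem IsFormIsometry.exists_small_displacement (hA : IsFormIsometry A) {n : ℂ × C2} {β : ℂ}
    (h0 : n ≠ 0) (hn : quad n = 0) (h : A n = β • n) (hβ : ‖β‖ = 1) {ε : ℝ} (hε : 0 < ε)
    (hε1 : ε ≤ 1) :
    ∃ x, quad x < 0 ∧ (1 - ε) * ‖form x (A x)‖ ^ 2 ≤ quad x ^ 2 := by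
  set m := (-(form originVec n)⁻¹) • n with hm
  have hom : form originVec m = -1 := exists_smul_form_eq_neg_one (form_originVec_ne_zero hn h0)
  have hmo : form m originVec = -1 := by rw [← conj_form, hom]; simp
  have hAm : A m = β • m := by rw [hm, map_smul, h, smul_comm]
  have hmm : form m m = 0 := by rw [form_self, hm, quad_smul, hn]; simp
  have hβ' : conj β * β = 1 := by rw [mul_comm, Complex.mul_conj', hβ]; simp
  have hmA : form m (A originVec) = -β := by
    have h1 := hA.conj_mul_form hAm originVec
    rw [hmo] at h1
    calc form m (A originVec) = (conj β * β) * form m (A originVec) := by rw [hβ', one_mul]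
      _ = β * (conj β * form m (A originVec)) := by ring
      _ = -β := by rw [h1]; ring
  set C := ‖form originVec (A originVec)‖ with hC
  -- Along the ray, `quad` is `-1 - 2 t` and `form x (A x)` is bounded by `C + 2 t`, so that
  -- their ratio is close to `1` if `t` is large compared with `C`.
  set t : ℝ := C / ε with ht
  have ht0 : 0 ≤ t := by positivity
  have htC : ε * t = C := by rw [ht]; field_simp
  refine ⟨originVec + (t : ℂ) • m, ?_, ?_⟩
  all_goals
    have hq : quad (originVec + (t : ℂ) • m) = -1 - 2 * t := by
      apply quad_eq_of_form
      simp [-Complex.coe_smul, form_self originVec, quad_originVec, hom, hmo, hmm]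
      ring
  · rw [hq]; linarith
  · have hf : form (originVec + (t : ℂ) • m) (A (originVec + (t : ℂ) • m)) =
        form originVec (A originVec) - 2 * t * β := by
      simp [-Complex.coe_smul, hAm, hom, hmA, hmm]
      ring
    have hle : ‖form (originVec + (t : ℂ) • m) (A (originVec + (t : ℂ) • m))‖ ≤ C + 2 * t := by
      rw [hf]
      refine (norm_sub_le _ _).trans ?_
      simp [hβ, abs_of_nonneg ht0, hC]
    rw [hq]
    calc _ ≤ (1 - ε) * (C + 2 * t) ^ 2 := by
          gcongr
      _ = t ^ 2 * ((1 - ε) * (ε + 2) ^ 2) := by rw [← htC]; ring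
      _ ≤ t ^ 2 * 4 := by
          gcongr
          nlinarith [pow_pos hε 3, sq_nonneg ε]
      _ ≤ _ := by nlinarith

theorem quadratic_eq_zero {a b c x y z : ℂ} (hxy : x ≠ y) (hxz : x ≠ z) (hyz : y ≠ z)
    (hx : a + b * x + c * x ^ 2 = 0) (hy : a + b * y + c * y ^ 2 = 0)
    (hz : a + b * z + c * z ^ 2 = 0) : a = 0 ∧ b = 0 ∧ c = 0 := by
  have h1 : b + c * (x + y) = 0 :=
    mul_left_cancel₀ (sub_ne_zero.2 hxy) (by linear_combination hx - hy)
  have h2 : b + c * (x + z) = 0 :=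
    mul_left_cancel₀ (sub_ne_zero.2 hxz) (by linear_combination hx - hz)
  have hc : c = 0 := mul_left_cancel₀ (sub_ne_zero.2 hyz) (by linear_combination h1 - h2)
  subst hc
  have hb : b = 0 := by simpa using h1
  subst hb
  exact ⟨by simpa using hx, rfl, rfl⟩

/-- If a null eigenvector has an eigenvalue `β` with `‖β‖ ≠ 1`, then the three eigenvalues `β`, `μ`
with `‖μ‖ = 1` and `(conj β)⁻¹` are distinct, and a suitable sum of eigenvectors is a negative
cyclic vector. -/
theorem IsFormIsometry.exists_cyclic (hA : IsFormIsometry A) {n : ℂ × C2} {β : ℂ}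
    (h0 : n ≠ 0) (hn : quad n = 0) (h : A n = β • n) (hβ : ‖β‖ ≠ 1) :
    ∃ x, quad x < 0 ∧ ∀ a b c : ℂ, a • x + b • A x + c • A (A x) = 0 → a = 0 ∧ b = 0 ∧ c = 0 := by
  have hβ0 := hA.eigenvalue_ne_zero hn h0 h
  have hβp : 0 < ‖β‖ := norm_pos_iff.2 hβ0
  set ν := (conj β)⁻¹ with hν
  have hcβ : conj β ≠ 0 := by simpa using hβ0
  have hνn : ‖ν‖ = ‖β‖⁻¹ := by simp [hν]
  -- The range of `A - ν` is orthogonal to `n`, hence `ν` is an eigenvalue.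
  obtain ⟨m₀, hm0, hAm0⟩ : ∃ m, m ≠ 0 ∧ A m = ν • m := by
    set T := A - ν • LinearMap.id with hT
    have hrange : ∀ x, form n (T x) = 0 := by
      intro x
      have h1 := hA.conj_mul_form h x
      have h2 : form n (A x) = ν * form n x := by rw [hν, ← h1, inv_mul_cancel_left₀ hcβ]
      simp [hT, h2]
    have hinj : ¬ Function.Injective T := by
      intro hi
      obtain ⟨y, hy⟩ := (LinearMap.injective_iff_surjective.1 hi) originVec
      have := hrange y
      rw [hy] at this
      exact form_originVec_ne_zero hn h0 (form_eq_zero_symm this)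
    rw [← LinearMap.ker_eq_bot] at hinj
    obtain ⟨m, hm, hm0⟩ := Submodule.exists_mem_ne_zero_of_ne_bot hinj
    refine ⟨m, hm0, ?_⟩
    have : T m = 0 := hm
    simpa [hT, sub_eq_zero] using this
  have hβν : ‖β‖ ≠ ‖ν‖ := by
    rw [hνn]
    intro h1
    have : ‖β‖ ^ 2 = 1 := by
      rw [pow_two]
      nth_rw 2 [h1]
      exact mul_inv_cancel₀ hβp.ne'
    exact hβ ((pow_eq_one_iff_of_nonneg hβp.le two_ne_zero).1 this)
  have hν1 : ‖ν‖ ≠ 1 := by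
    rw [hνn]
    simpa using hβ
  have hqm0 : quad m₀ = 0 := by
    have h1 := hA.quad_eq m₀
    rw [hAm0, quad_smul] at h1
    by_contra hq
    have h2 : ‖ν‖ ^ 2 = 1 := by
      have : (‖ν‖ ^ 2 - 1) * quad m₀ = 0 := by linarith
      rcases mul_eq_zero.1 this with h3 | h3
      · linarith
      · exact absurd h3 hq
    exact hν1 ((pow_eq_one_iff_of_nonneg (norm_nonneg _) two_ne_zero).1 h2)
  have hnm0 : form n m₀ ≠ 0 := by
    intro h1
    obtain ⟨c, rfl⟩ := exists_smul_of_null hn hqm0 h1 h0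
    rw [map_smul, h, smul_comm] at hAm0
    have : (β - ν) • (c • n) = 0 := by rw [sub_smul, hAm0, sub_self]
    rcases smul_eq_zero.1 this with h2 | h2
    · exact hβν (by rw [sub_eq_zero.1 h2])
    · exact hm0 h2
  set m := (-(form n m₀)⁻¹) • m₀ with hm
  have hnm : form n m = -1 := exists_smul_form_eq_neg_one hnm0
  have hmn : form m n = -1 := by rw [← conj_form, hnm]; simp
  have hmm : form m m = 0 := by rw [form_self, hm, quad_smul, hqm0]; simp
  have hnn : form n n = 0 := by rw [form_self, hn]; simp
  have hAm : A m = ν • m := by rw [hm, map_smul, hAm0, smul_comm]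
  have hqm : quad m = 0 := quad_eq_of_form (by simpa using hmm)
  have hm0' : m ≠ 0 := by
    intro h1
    rw [h1] at hnm
    simp at hnm
  have hν0 := hA.eigenvalue_ne_zero hqm hm0' hAm
  obtain ⟨e, hem, he0, μ, hAe⟩ := exists_eigenvector_mem A ((form n).ker ⊓ (form m).ker) (by
    rintro x ⟨hx1, hx2⟩
    have h1 := hA.conj_mul_form h x
    have h2 := hA.conj_mul_form hAm x
    have hx1' : form n x = 0 := hx1
    have hx2' : form m x = 0 := hx2
    rw [hx1'] at h1
    rw [hx2'] at h2
    exact ⟨by simpa [hβ0] using h1, by simpa [hν0] using h2⟩) (orthogonal_inf_orthogonal_ne_bot n m)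
  have hne : form n e = 0 := hem.1
  have hme : form m e = 0 := hem.2
  have hen := form_eq_zero_symm hne
  have hem' := form_eq_zero_symm hme
  have hqe : quad e ≠ 0 := by
    intro h1
    obtain ⟨c, rfl⟩ := exists_smul_of_null hn h1 hne h0
    have : c = 0 := by simpa [hmn] using hme
    exact he0 (by simp [this])
  have hμ : ‖μ‖ = 1 := by
    have h1 := hA.quad_eq e
    rw [hAe, quad_smul] at h1
    have h2 : ‖μ‖ ^ 2 = 1 := mul_right_cancel₀ hqe (by linarith)
    exact (pow_eq_one_iff_of_nonneg (norm_nonneg _) two_ne_zero).1 h2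
  -- `quad (n + e + s • m) = quad e - 2 * s` is negative for large `s`.
  set s : ℝ := |quad e| + 1 with hs
  have hs0 : 0 < s := by positivity
  have hsC : (s : ℂ) ≠ 0 := by exact_mod_cast hs0.ne'
  refine ⟨n + e + (s : ℂ) • m, ?_, ?_⟩
  · have : quad (n + e + (s : ℂ) • m) = quad e - 2 * s := by
      apply quad_eq_of_form
      simp [-Complex.coe_smul, hnn, hmm, hnm, hmn, hne, hme, hen, hem', form_self e]
      ring
    rw [this]
    have := le_abs_self (quad e)
    linarith [abs_nonneg (quad e)]
  · intro a b c habc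
    simp only [map_add, map_smul, h, hAm, hAe] at habc
    have hp1 := congrArg (form m) habc
    have hp2 := congrArg (form n) habc
    have hp3 := congrArg (form e) habc
    simp only [map_add, map_smul, hnn, hmm, hnm, hmn, hne, hme, hen, hem', form_self e,
      smul_eq_mul, map_zero] at hp1 hp2 hp3
    refine quadratic_eq_zero (x := β) (y := ν) (z := μ) (fun h1 => hβν (by rw [h1]))
      (fun h1 => hβ (by rw [h1, hμ])) (fun h1 => hν1 (by rw [h1, hμ])) ?_ ?_ ?_
    · linear_combination -hp1
    · refine mul_left_cancel₀ hsC ?_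
      linear_combination -hp2
    · refine mul_left_cancel₀ (a := (quad e : ℂ)) (by exact_mod_cast hqe) ?_
      linear_combination hp3

end Isometry

/-! ### Almost extremal discs in the ball -/

theorem norm_sub_le_of_norm_inner_sub_one_le {p w : C2} {η : ℝ} (hη : 0 ≤ η) (hp : ‖p‖ ^ 2 ≤ 1)
    (hw : ‖w‖ ≤ 1) (h : ‖inner ℂ p w - 1‖ ≤ η ^ 2 / 2) : ‖w - p‖ ≤ η := by
  have hre : 1 - η ^ 2 / 2 ≤ (inner ℂ p w).re := by
    have := (abs_le.1 ((Complex.abs_re_le_norm (inner ℂ p w - 1)).trans h)).1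
    simp only [Complex.sub_re, Complex.one_re] at this
    linarith
  have h1 : ‖w‖ ^ 2 ≤ 1 := pow_le_one₀ (norm_nonneg _) hw
  have h2 : ‖w - p‖ ^ 2 = ‖w‖ ^ 2 - 2 * (inner ℂ p w).re + ‖p‖ ^ 2 := by
    rw [norm_sub_sq (𝕜 := ℂ), inner_re_symm]
    rfl
  exact le_of_sq_le_sq (by rw [h2]; linarith) hη

open Metric in
/-- A holomorphic self-map of the disc fixing `0` whose derivative at `0` is close to `1` is close
to the identity, by the Schwarz lemma and the Borel–Carathéodory inequality. -/
theorem norm_div_sub_one_le {ψ : ℂ → ℂ} {δ : ℝ} (hδ : 0 < δ)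
    (hψd : DifferentiableOn ℂ ψ (ball 0 1)) (hψ0 : ψ 0 = 0)
    (hψle : ∀ t ∈ ball (0 : ℂ) 1, ‖ψ t‖ ≤ 1) (hψ' : ‖deriv ψ 0 - 1‖ ≤ δ) {t : ℂ}
    (ht : ‖t‖ < 1) (ht0 : t ≠ 0) : ‖ψ t / t - 1‖ ≤ 4 * δ / (1 - ‖t‖) := by
  have hχle : ∀ s ∈ ball (0 : ℂ) 1, ‖dslope ψ 0 s‖ ≤ 1 := fun s hs => by
    simpa using Complex.norm_dslope_le_div_of_mapsTo_ball (R₂ := 1) hψd (fun s hs => by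
      simpa [hψ0] using hψle s hs) hs
  have hχd : DifferentiableOn ℂ (dslope ψ 0) (ball 0 1) :=
    (Complex.differentiableOn_dslope (isOpen_ball.mem_nhds (by simp))).2 hψd
  have h1 := Complex.borelCaratheodory (f := fun s => dslope ψ 0 s - 1) (R := 1) hδ
    (hχd.sub_const 1) (fun s hs => by
      have h2 := (Complex.re_le_norm (dslope ψ 0 s)).trans (hχle s hs)
      simp only [Set.mem_ofPred_eq, Complex.sub_re, Complex.one_re]
      linarith) one_pos (z := t) (by simpa using ht)
  have h2 : dslope ψ 0 t = ψ t / t := by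
    rw [dslope_of_ne _ ht0, slope_def_field, hψ0, sub_zero, sub_zero]
  rw [h2, dslope_same] at h1
  have h3 : 0 < 1 - ‖t‖ := by linarith
  calc _ ≤ _ := h1
    _ ≤ 2 * δ * 1 / (1 - ‖t‖) + δ * (1 + 1) / (1 - ‖t‖) := by gcongr
    _ = _ := by ring

open Metric in
/-- Quantitative uniqueness of extremal discs centred at the midpoint `c` of an affine disc
`t ↦ c + R t u`: a holomorphic disc `g` in the ball with `g(0) = c` and `g'(0) = r R u`, where `r`
is close to `1`, is uniformly close to this affine disc on a smaller disc. -/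
theorem exists_close_of_almost_extremal {c u : C2} {R : ℝ} (hu : ‖u‖ = 1) (hcu : inner ℂ c u = 0)
    (hR : 0 < R) (hRc : ‖c‖ ^ 2 + R ^ 2 = 1) {ρ η : ℝ} (hρ : ρ < 1) (hη : 0 < η) :
    ∃ δ > 0, ∀ r : ℝ, 1 - δ < r → ∀ g : ℂ → C2, DifferentiableOn ℂ g (ball 0 1) →
      Set.MapsTo g (ball 0 1) (ball 0 1) → g 0 = c → deriv g 0 = ((r * R : ℝ) : ℂ) • u →
      ∀ t : ℂ, ‖t‖ ≤ ρ → ‖g t - (c + (R * t) • u)‖ ≤ η := by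
  -- On the circle of radius `ρ₁`, the defects `1 / ρ₁ - ρ₁` of the model disc and
  -- `4 * δ / (1 - ρ₁)` of the Borel–Carathéodory bound are both at most `η ^ 2 / 4`.
  obtain ⟨ρ₁, hρρ₁, hhalf, hη₁, hρ₁⟩ :
      ∃ ρ₁, ρ ≤ ρ₁ ∧ 1 / 2 ≤ ρ₁ ∧ 1 - η ^ 2 / 16 ≤ ρ₁ ∧ ρ₁ < 1 := by
    refine ⟨max ρ (max (1 / 2) (1 - η ^ 2 / 16)), le_max_left _ _,
      (le_max_left _ _).trans (le_max_right _ _), (le_max_right _ _).trans (le_max_right _ _), ?_⟩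
    have : 0 < η ^ 2 := by positivity
    exact max_lt hρ (max_lt (by norm_num) (by linarith))
  have hρ0 : 0 < ρ₁ := by linarith
  have h1ρ : 0 < 1 - ρ₁ := by linarith
  have hR1 : R ^ 2 ≤ 1 := by nlinarith [sq_nonneg ‖c‖]
  have hRle : R ≤ 1 := by nlinarith
  have huc : inner ℂ u c = 0 := inner_eq_zero_symm.1 hcu
  refine ⟨(1 - ρ₁) * η ^ 2 / 16, by positivity, fun r hr g hg hmaps hg0 hg1 => ?_⟩
  set δ := (1 - ρ₁) * η ^ 2 / 16 with hδ
  have hδ0 : 0 < δ := by positivity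
  have hgn : ∀ t ∈ ball (0 : ℂ) 1, ‖g t‖ < 1 := fun t ht => by simpa using hmaps ht
  have hdiff_inner : ∀ w : C2, DifferentiableOn ℂ (fun t => inner ℂ w (g t)) (ball 0 1) := fun w =>
    (innerSL ℂ w).differentiable.comp_differentiableOn hg
  -- On the unit circle, `ψ t / t` is the inner product of the model disc with `g`.
  set ψ : ℂ → ℂ := fun t => t * inner ℂ c (g t) + R * inner ℂ u (g t) with hψ
  have hψd : DifferentiableOn ℂ ψ (ball 0 1) :=
    (differentiableOn_id.mul (hdiff_inner c)).add ((hdiff_inner u).const_mul _)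
  have hψ0 : ψ 0 = 0 := by simp [hψ, hg0, huc]
  have hψle : ∀ t ∈ ball (0 : ℂ) 1, ‖ψ t‖ ≤ 1 := by
    intro t ht
    have ht1 : ‖t‖ < 1 := by simpa using ht
    have h1 : ψ t = inner ℂ (conj t • c + (R : ℂ) • u) (g t) := by
      rw [hψ, inner_add_left, inner_smul_left, inner_smul_left, Complex.conj_conj,
        Complex.conj_ofReal]
    have h2 : ‖conj t • c + (R : ℂ) • u‖ ^ 2 ≤ 1 := by
      have h3 := norm_add_sq_eq_norm_sq_add_norm_sq_of_inner_eq_zero (𝕜 := ℂ)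
        (conj t • c) ((R : ℂ) • u)
        (by simp [-Complex.coe_smul, inner_smul_left, inner_smul_right, hcu])
      rw [← pow_two, ← pow_two, ← pow_two] at h3
      rw [h3, norm_smul, norm_smul, mul_pow, mul_pow, hu]
      simp only [RCLike.norm_conj, Complex.norm_real, Real.norm_eq_abs, sq_abs, one_pow, mul_one]
      have : ‖t‖ ^ 2 ≤ 1 := by nlinarith [norm_nonneg t]
      nlinarith [sq_nonneg ‖c‖]
    rw [h1]
    have h4 : ‖conj t • c + (R : ℂ) • u‖ ≤ 1 := by
      nlinarith [norm_nonneg (conj t • c + (R : ℂ) • u)]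
    calc _ ≤ ‖conj t • c + (R : ℂ) • u‖ * ‖g t‖ := norm_inner_le_norm _ _
      _ ≤ 1 * 1 := by
        gcongr
        exact (hgn t ht).le
      _ = 1 := one_mul 1
  have h0mem : (0 : ℂ) ∈ ball (0 : ℂ) 1 := by simp
  have hψ' : deriv ψ 0 = ((‖c‖ ^ 2 + r * R ^ 2 : ℝ) : ℂ) := by
    have hgd : HasDerivAt g (((r * R : ℝ) : ℂ) • u) 0 := by
      rw [← hg1]
      exact (hg.differentiableAt (isOpen_ball.mem_nhds h0mem)).hasDerivAt
    have hin : ∀ w : C2, HasDerivAt (fun t => inner ℂ w (g t))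
        (inner ℂ w (((r * R : ℝ) : ℂ) • u)) 0 := fun w =>
      (innerSL ℂ w).hasFDerivAt.comp_hasDerivAt (0 : ℂ) hgd
    have h1 := ((hasDerivAt_id (0 : ℂ)).mul (hin c)).add ((hin u).const_mul (R : ℂ))
    have h2 : HasDerivAt ψ _ 0 := h1
    rw [h2.deriv, inner_smul_right, inner_smul_right, hcu, inner_self_eq_norm_sq_to_K, hu, hg0,
      inner_self_eq_norm_sq_to_K]
    push_cast
    simp
    ring
  have hψ1 : ‖deriv ψ 0 - 1‖ ≤ δ := by
    have h1 : ‖deriv ψ 0‖ ≤ 1 := by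
      simpa using Complex.norm_deriv_le_div_of_mapsTo_ball (R₂ := 1) hψd (fun s hs => by
        simpa [hψ0] using hψle s hs) one_pos
    rw [hψ', Complex.norm_real, Real.norm_eq_abs] at h1
    have h2 := (abs_le.1 h1).2
    rw [hψ', ← Complex.ofReal_one, ← Complex.ofReal_sub, Complex.norm_real, Real.norm_eq_abs,
      abs_le]
    constructor
    · nlinarith
    · linarith
  have hcircle : ∀ t : ℂ, ‖t‖ = ρ₁ → ‖g t - (c + (R * t) • u)‖ ≤ η := by
    intro t ht
    have htm : t ∈ ball (0 : ℂ) 1 := by simpa [ht] using hρ₁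
    have ht0 : t ≠ 0 := by
      rintro rfl
      simp at ht
      linarith
    set P := c + (R * t) • u with hP
    have hPn : ‖P‖ ^ 2 ≤ 1 := by
      have h3 := norm_add_sq_eq_norm_sq_add_norm_sq_of_inner_eq_zero (𝕜 := ℂ)
        c ((R * t) • u) (by simp [inner_smul_right, hcu])
      rw [← pow_two, ← pow_two, ← pow_two, ← hP] at h3
      rw [h3, norm_smul, hu, norm_mul, ht, Complex.norm_real, Real.norm_eq_abs, abs_of_pos hR]
      have : ρ₁ ^ 2 ≤ 1 := by nlinarith
      nlinarith [sq_nonneg R]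
    have hu1 : ‖inner ℂ u (g t)‖ ≤ 1 := by
      calc _ ≤ ‖u‖ * ‖g t‖ := norm_inner_le_norm _ _
        _ ≤ 1 := by rw [hu, one_mul]; exact (hgn t htm).le
    have htt : conj t * t = (ρ₁ : ℂ) ^ 2 := by rw [mul_comm, Complex.mul_conj', ht]
    have hin : inner ℂ P (g t) - 1 = (ψ t / t - 1) - R * (1 - ρ₁ ^ 2) / t * inner ℂ u (g t) := by
      have h1 : inner ℂ P (g t) = inner ℂ c (g t) + R * conj t * inner ℂ u (g t) := by
        rw [hP, inner_add_left, inner_smul_left, map_mul, Complex.conj_ofReal]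
      rw [h1, hψ]
      field_simp
      linear_combination (R * inner ℂ u (g t)) * htt
    have hin1 : ‖inner ℂ P (g t) - 1‖ ≤ η ^ 2 / 2 := by
      rw [hin]
      refine (norm_sub_le _ _).trans ?_
      have h2 : ‖(R : ℂ) * (1 - ρ₁ ^ 2) / t * inner ℂ u (g t)‖ ≤ η ^ 2 / 4 := by
        have h3 : ‖(R : ℂ) * (1 - ρ₁ ^ 2) / t‖ = R * (1 - ρ₁ ^ 2) / ρ₁ := by
          rw [norm_div, norm_mul, ht, Complex.norm_real, Real.norm_eq_abs, abs_of_pos hR]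
          have : (1 - (ρ₁ : ℂ) ^ 2) = ((1 - ρ₁ ^ 2 : ℝ) : ℂ) := by push_cast; ring
          rw [this, Complex.norm_real, Real.norm_eq_abs, abs_of_nonneg (by nlinarith)]
        rw [norm_mul, h3]
        have h4 : R * (1 - ρ₁ ^ 2) / ρ₁ ≤ η ^ 2 / 4 := by
          rw [div_le_iff₀ hρ0]
          have h5 : 1 - ρ₁ ^ 2 = (1 - ρ₁) * (1 + ρ₁) := by ring
          have h6 : (1 - ρ₁) * (1 + ρ₁) ≤ η ^ 2 / 16 * 2 := by
            gcongr <;> linarith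
          have h7 : η ^ 2 / 4 * (1 / 2) ≤ η ^ 2 / 4 * ρ₁ := by gcongr
          have h8 : R * (1 - ρ₁ ^ 2) ≤ 1 * (1 - ρ₁ ^ 2) := by
            gcongr
            nlinarith
          linarith
        calc _ ≤ η ^ 2 / 4 * 1 := by gcongr
          _ = _ := mul_one _
      have h3 := norm_div_sub_one_le hδ0 hψd hψ0 hψle hψ1 (ht.trans_lt hρ₁) ht0
      rw [ht] at h3
      have h4 : 4 * δ / (1 - ρ₁) = η ^ 2 / 4 := by rw [hδ]; field_simp; norm_num
      linarith
    exact norm_sub_le_of_norm_inner_sub_one_le hη.le hPn (hgn t htm).le hin1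
  intro t ht
  have hsub : closedBall (0 : ℂ) ρ₁ ⊆ ball 0 1 := closedBall_subset_ball hρ₁
  have hd : DifferentiableOn ℂ (fun t => g t - (c + (R * t) • u)) (ball 0 1) :=
    hg.sub (by fun_prop)
  refine Complex.norm_le_of_forall_mem_frontier_norm_le (isBounded_ball (x := (0 : ℂ)) (r := ρ₁))
    (f := fun t => g t - (c + (R * t) • u)) ?_ ?_ ?_
  · apply DifferentiableOn.diffContOnCl
    rw [closure_ball _ hρ0.ne']
    exact hd.mono hsub
  · intro z hz
    rw [frontier_ball _ hρ0.ne'] at hz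
    exact hcircle z (by simpa using hz)
  · rw [closure_ball _ hρ0.ne']
    simpa using ht.trans hρρ₁

/-! ### Stability of transversal intersections -/

open Metric in
/-- The Cauchy estimate: a small holomorphic curve is Lipschitz with a small constant. -/
theorem norm_sub_le_of_norm_le_ball {e : ℂ → C2} {z : ℂ} {ε δ : ℝ} (hε : 0 < ε)
    (he : DifferentiableOn ℂ e (ball z ε)) (hδ : ∀ x ∈ ball z ε, ‖e x‖ ≤ δ)
    {x y : ℂ} (hx : x ∈ ball z (ε / 2)) (hy : y ∈ ball z (ε / 2)) :
    ‖e x - e y‖ ≤ δ / (ε / 2) * ‖x - y‖ := by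
  have hsub : ∀ w ∈ ball z (ε / 2), closedBall w (ε / 2) ⊆ ball z ε := by
    intro w hw p hp
    rw [mem_ball] at hw ⊢
    rw [mem_closedBall] at hp
    linarith [dist_triangle p w z]
  refine (convex_ball z (ε / 2)).norm_image_sub_le_of_norm_deriv_le (f := e) (𝕜 := ℂ)
    (fun w hw => ?_) (fun w hw => ?_) hy hx
  · exact he.differentiableAt (isOpen_ball.mem_nhds (ball_subset_ball (by linarith) hw))
  · refine Complex.norm_deriv_le_of_forall_mem_sphere_norm_le (by positivity) ?_ ?_
    · apply DifferentiableOn.diffContOnCl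
      rw [closure_ball _ (by positivity)]
      exact he.mono (hsub w hw)
    · exact fun p hp => hδ p (hsub w hw (sphere_subset_closedBall hp))

open Metric in
/-- If two holomorphic curves in `ℂ²` meet transversally, then so do all nearby curves. -/
theorem exists_crossing_of_close {a b : ℂ → C2} {s₀ t₀ : ℂ} {ε : ℝ} (hε : 0 < ε)
    (ha : DifferentiableOn ℂ a (ball s₀ ε)) (hb : DifferentiableOn ℂ b (ball t₀ ε))
    (hab : a s₀ = b t₀)
    (hind : ∀ x y : ℂ, x • deriv a s₀ = y • deriv b t₀ → x = 0 ∧ y = 0) :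
    ∃ δ > 0, ∀ a' b' : ℂ → C2, DifferentiableOn ℂ a' (ball s₀ ε) →
      DifferentiableOn ℂ b' (ball t₀ ε) → (∀ s ∈ ball s₀ ε, ‖a' s - a s‖ ≤ δ) →
      (∀ t ∈ ball t₀ ε, ‖b' t - b t‖ ≤ δ) → ∃ s ∈ ball s₀ ε, ∃ t ∈ ball t₀ ε, a' s = b' t := by
  set A : ℂ × ℂ →L[ℂ] C2 :=
    (ContinuousLinearMap.toSpanSingleton ℂ (deriv a s₀)).comp (ContinuousLinearMap.fst ℂ ℂ ℂ) -
    (ContinuousLinearMap.toSpanSingleton ℂ (deriv b t₀)).comp (ContinuousLinearMap.snd ℂ ℂ ℂ)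
    with hA
  have hAinj : Function.Injective (A : ℂ × ℂ →ₗ[ℂ] C2) := by
    rw [injective_iff_map_eq_zero]
    rintro ⟨x, y⟩ hxy
    have h1 : x • deriv a s₀ = y • deriv b t₀ := by simpa [hA, sub_eq_zero] using hxy
    obtain ⟨rfl, rfl⟩ := hind x y h1
    rfl
  have hAsurj : A.range = ⊤ := by
    have h1 := (LinearMap.injective_iff_surjective_of_finrank_eq_finrank
      (f := (A : ℂ × ℂ →ₗ[ℂ] C2)) (by rw [finrank_C2]; simp)).1 hAinj
    exact LinearMap.range_eq_top.2 h1
  set S := A.nonlinearRightInverseOfSurjective hAsurj with hS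
  have hN : 0 < S.nnnorm := A.nonlinearRightInverseOfSurjective_nnnorm_pos hAsurj
  have hN' : (0 : ℝ) < (S.nnnorm : ℝ)⁻¹ := by positivity
  have has : HasStrictDerivAt a (deriv a s₀) s₀ :=
    (ha.analyticAt (isOpen_ball.mem_nhds (mem_ball_self hε))).hasStrictDerivAt
  have hbs : HasStrictDerivAt b (deriv b t₀) t₀ :=
    (hb.analyticAt (isOpen_ball.mem_nhds (mem_ball_self hε))).hasStrictDerivAt
  have hG : HasStrictFDerivAt (fun p : ℂ × ℂ => a p.1 - b p.2) A (s₀, t₀) := by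
    have h1 := HasStrictFDerivAt.comp (s₀, t₀) (g := a) (f := Prod.fst) has.hasStrictFDerivAt
      hasStrictFDerivAt_fst
    have h2 := HasStrictFDerivAt.comp (s₀, t₀) (g := b) (f := Prod.snd) hbs.hasStrictFDerivAt
      hasStrictFDerivAt_snd
    exact h1.sub h2
  obtain ⟨U, hU, hlin⟩ := hG.approximates_deriv_on_nhds (c := S.nnnorm⁻¹ / 4)
    (Or.inr (by positivity))
  obtain ⟨r₀, hr₀, hrU⟩ := Metric.mem_nhds_iff.1 hU
  set r := min (r₀ / 2) (ε / 4) with hr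
  have hr0 : 0 < r := by positivity
  have hrr : r < r₀ := (min_le_left _ _).trans_lt (by linarith)
  have hrε : r ≤ ε / 4 := min_le_right _ _
  set δ := (S.nnnorm : ℝ)⁻¹ * r / 8 with hδ
  have hδ0 : 0 < δ := by positivity
  refine ⟨δ, hδ0, fun a' b' ha' hb' haa hbb => ?_⟩
  have hmem : ∀ p ∈ closedBall (s₀, t₀) r, p.1 ∈ ball s₀ (ε / 2) ∧ p.2 ∈ ball t₀ (ε / 2) := by
    rintro ⟨x, y⟩ hp
    rw [← closedBall_prod_same] at hp
    obtain ⟨h1, h2⟩ := hp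
    simp only [mem_closedBall] at h1 h2
    exact ⟨mem_ball.2 (h1.trans_lt (by linarith)), mem_ball.2 (h2.trans_lt (by linarith))⟩
  have happ : ApproximatesLinearOn (fun p : ℂ × ℂ => a' p.1 - b' p.2) A (closedBall (s₀, t₀) r)
      (S.nnnorm⁻¹ / 2) := by
    rw [ApproximatesLinearOn]
    intro p hp q hq
    obtain ⟨hp1, hp2⟩ := hmem p hp
    obtain ⟨hq1, hq2⟩ := hmem q hq
    have hsub := (closedBall_subset_ball hrr).trans hrU
    have h1 := hlin p (hsub hp) q (hsub hq)
    have h2 := norm_sub_le_of_norm_le_ball hε (ha'.sub ha) haa hp1 hq1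
    have h3 := norm_sub_le_of_norm_le_ball hε (hb'.sub hb) hbb hp2 hq2
    have h4 : δ / (ε / 2) ≤ (S.nnnorm : ℝ)⁻¹ / 8 := by
      rw [div_le_iff₀ (by positivity), hδ]
      nlinarith
    have h5 : ‖p.1 - q.1‖ ≤ ‖p - q‖ := norm_fst_le (p - q)
    have h6 : ‖p.2 - q.2‖ ≤ ‖p - q‖ := norm_snd_le (p - q)
    have h7 : δ / (ε / 2) * ‖p.1 - q.1‖ ≤ (S.nnnorm : ℝ)⁻¹ / 8 * ‖p - q‖ := by gcongr
    have h8 : δ / (ε / 2) * ‖p.2 - q.2‖ ≤ (S.nnnorm : ℝ)⁻¹ / 8 * ‖p - q‖ := by gcongr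
    have h9 : a' p.1 - b' p.2 - (a' q.1 - b' q.2) - A (p - q) =
        (a p.1 - b p.2 - (a q.1 - b q.2) - A (p - q)) + ((a' - a) p.1 - (a' - a) q.1) -
          ((b' - b) p.2 - (b' - b) q.2) := by
      simp only [Pi.sub_apply]
      abel
    simp only [h9]
    refine (norm_sub_le _ _).trans ((add_le_add_left (norm_add_le _ _) _).trans ?_)
    push_cast at h1 ⊢
    linarith
  have hsurj := happ.surjOn_closedBall_of_nonlinearRightInverse S hr0.le (b := (s₀, t₀))
    Set.Subset.rfl
  obtain ⟨p, hp, hp0⟩ := hsurj (show (0 : C2) ∈ _ by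
    rw [mem_closedBall, dist_comm, dist_zero_right]
    have h1 := haa s₀ (mem_ball_self hε)
    have h2 := hbb t₀ (mem_ball_self hε)
    have h3 : a' s₀ - b' t₀ = (a' s₀ - a s₀) - (b' t₀ - b t₀) := by rw [hab]; abel
    simp only
    rw [h3]
    refine (norm_sub_le _ _).trans ?_
    push_cast
    have h4 : (S.nnnorm : ℝ)⁻¹ * r = 8 * δ := by rw [hδ]; ring
    nlinarith)
  obtain ⟨h1, h2⟩ := hmem p hp
  exact ⟨p.1, ball_subset_ball (by linarith) h1, p.2, ball_subset_ball (by linarith) h2,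
    sub_eq_zero.1 hp0⟩

/-! ### The ball as an open subset of `ℂ²` -/

theorem zero_mem_unitBall : (0 : C2) ∈ unitBall := Metric.mem_ball_self one_pos

theorem norm_coe_unitBall (z : unitBall) : ‖(z : C2)‖ < 1 := mem_ball_zero_iff.1 z.2

/-- The inverse of the inclusion of the ball in `ℂ²`, given by a chart of the ball; only its values
on the ball are meaningful. -/
def toBall : C2 → unitBall := (chartAt C2 (⟨0, zero_mem_unitBall⟩ : unitBall)).symm

theorem chartAt_target_unitBall (x : unitBall) :
    (chartAt C2 x).target = Metric.ball (0 : C2) 1 := by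
  rw [TopologicalSpace.Opens.chartAt_eq, OpenPartialHomeomorph.subtypeRestr_def,
    OpenPartialHomeomorph.trans_target, chartAt_self_eq]
  simp only [OpenPartialHomeomorph.refl_target, OpenPartialHomeomorph.refl_symm,
    OpenPartialHomeomorph.refl_apply, Set.univ_inter,
    TopologicalSpace.Opens.openPartialHomeomorphSubtypeCoe_target]
  rfl

theorem coe_toBall {z : C2} (hz : ‖z‖ < 1) : (toBall z : C2) = z := by
  have h1 := (chartAt C2 ((⟨0, zero_mem_unitBall⟩ : unitBall) : C2)).subtypeRestr_symm_eqOn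
    ⟨⟨0, zero_mem_unitBall⟩⟩ (U := unitBall)
  have h2 : z ∈ (chartAt C2 (⟨0, zero_mem_unitBall⟩ : unitBall)).target := by
    rw [chartAt_target_unitBall]
    simpa using hz
  exact (h1 h2).symm

theorem toBall_coe (z : unitBall) : toBall (z : C2) = z :=
  Subtype.ext (coe_toBall (norm_coe_unitBall z))

theorem contMDiffOn_toBall : ContMDiffOn 𝓘(ℂ, C2) 𝓘(ℂ, C2) ω toBall (Metric.ball 0 1) := by
  rw [← chartAt_target_unitBall ⟨0, zero_mem_unitBall⟩]
  exact contMDiffOn_chart_symm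

/-- A self-map of the ball, in the coordinates of `ℂ²`; only its values on the ball are meaningful. -/
def coordMap (φ : unitBall → unitBall) (z : C2) : C2 := φ (toBall z)

theorem coordMap_coe (φ : unitBall → unitBall) (z : unitBall) : coordMap φ z = φ z := by
  rw [coordMap, toBall_coe]

theorem differentiableOn_coordMap {φ : unitBall → unitBall}
    (hφ : ContMDiff 𝓘(ℂ, C2) 𝓘(ℂ, C2) ω φ) :
    DifferentiableOn ℂ (coordMap φ) (Metric.ball 0 1) := by
  have h1 : ContMDiffOn 𝓘(ℂ, C2) 𝓘(ℂ, C2) ω (coordMap φ) (Metric.ball 0 1) :=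
    (contMDiff_subtype_val.comp hφ).comp_contMDiffOn contMDiffOn_toBall
  exact (contMDiffOn_iff_contDiffOn.1 h1).differentiableOn (by simp)

theorem norm_coordMap_lt (φ : unitBall → unitBall) (z : C2) : ‖coordMap φ z‖ < 1 :=
  norm_coe_unitBall _

/-! ### Automorphisms of the ball are projective -/

theorem quad_one_mk_neg {z : C2} (hz : ‖z‖ < 1) : quad ((1 : ℂ), z) < 0 := by
  simp only [quad, norm_one]
  nlinarith [norm_nonneg z]

theorem fst_ne_zero_of_quad_neg {x : ℂ × C2} (hx : quad x < 0) : x.1 ≠ 0 := by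
  intro h
  simp only [quad, h, norm_zero] at hx
  nlinarith [sq_nonneg ‖x.2‖]

/-- The map induced by a linear map of `ℂ × ℂ²` on the affine chart `z ↦ (1, z)` of the projective
plane. -/
def affineMap (A : (ℂ × C2) →ₗ[ℂ] (ℂ × C2)) (z : C2) : C2 := (A (1, z)).1⁻¹ • (A (1, z)).2

section Isometry

variable {A : (ℂ × C2) →ₗ[ℂ] (ℂ × C2)}

theorem IsFormIsometry.fst_ne_zero (hA : IsFormIsometry A) {z : C2} (hz : ‖z‖ < 1) :
    (A (1, z)).1 ≠ 0 :=
  fst_ne_zero_of_quad_neg (by rw [hA.quad_eq]; exact quad_one_mk_neg hz)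

theorem IsFormIsometry.eq_smul_affineMap (hA : IsFormIsometry A) {z : C2} (hz : ‖z‖ < 1) :
    A (1, z) = (A (1, z)).1 • ((1 : ℂ), affineMap A z) := by
  have h := hA.fst_ne_zero hz
  ext1
  · simp
  · simp [affineMap, smul_smul, h]

theorem norm_lt_one_of_quad_neg {z : C2} (h : quad ((1 : ℂ), z) < 0) : ‖z‖ < 1 := by
  simp only [quad, norm_one] at h
  nlinarith [norm_nonneg z]

theorem IsFormIsometry.norm_affineMap_lt (hA : IsFormIsometry A) {z : C2} (hz : ‖z‖ < 1) :
    ‖affineMap A z‖ < 1 := by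
  apply norm_lt_one_of_quad_neg
  have h1 := quad_one_mk_neg hz
  rw [← hA.quad_eq, hA.eq_smul_affineMap hz, quad_smul] at h1
  by_contra hc
  push Not at hc
  have := mul_nonneg (sq_nonneg ‖(A (1, z)).1‖) hc
  linarith

theorem affineMap_eq_of_smul {z w : C2} {a : ℂ} (ha : a ≠ 0) (h : A (1, z) = a • ((1 : ℂ), w)) :
    affineMap A z = w := by
  simp [affineMap, h, smul_smul, ha]

theorem IsFormIsometry.differentiableOn_affineMap (hA : IsFormIsometry A) :
    DifferentiableOn ℂ (affineMap A) (Metric.ball 0 1) := by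
  intro z hz
  have hz1 : ‖z‖ < 1 := by simpa using hz
  have h1 : DifferentiableAt ℂ (fun w : C2 => A (1, w)) z := by
    have : Differentiable ℂ (LinearMap.toContinuousLinearMap A) :=
      (LinearMap.toContinuousLinearMap A).differentiable
    exact (this _).comp z (DifferentiableAt.prodMk (differentiableAt_const _) differentiableAt_id)
  exact ((h1.fst.inv (hA.fst_ne_zero hz1)).smul h1.snd).differentiableWithinAt

end Isometry

/-- The complex reflection of `ℂ × ℂ²` in the vector `v`. If `v` is null, then `2 / form v v = 0` and
the reflection is the identity. -/
def reflect (v : ℂ × C2) : (ℂ × C2) →ₗ[ℂ] (ℂ × C2) :=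
  LinearMap.id - (2 / form v v) • (form v).smulRight v

theorem reflect_apply (v w : ℂ × C2) : reflect v w = w - (2 / form v v * form v w) • v := by
  simp [reflect, smul_smul]

theorem reflect_reflect (v w : ℂ × C2) : reflect v (reflect v w) = w := by
  rw [reflect_apply v w, map_sub, map_smul, reflect_apply v w, reflect_apply v v]
  by_cases h : form v v = 0
  · simp [h]
  · rw [div_mul_cancel₀ 2 h]
    module

theorem isFormIsometry_reflect (v : ℂ × C2) : IsFormIsometry (reflect v) := by
  intro x y
  by_cases h : form v v = 0
  · simp [reflect_apply, h]
  · have hc : conj (form v v) = form v v := conj_form v v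
    simp only [reflect_apply, map_sub, LinearMap.sub_apply, map_smulₛₗ, LinearMap.smul_apply,
      smul_eq_mul, RingHom.id_apply, map_mul, map_div₀, hc, conj_form]
    have h2 : conj (2 : ℂ) = 2 := Complex.conj_ofNat 2
    rw [h2]
    field_simp
    ring

/-- A reflection exchanging the origin of the ball with a given point: the reflection in the
difference of two representatives with the same square norm and a real product. -/
theorem exists_reflect_origin {z : C2} (hz : ‖z‖ < 1) :
    ∃ v, ∃ a : ℂ, a ≠ 0 ∧ reflect v (1, 0) = a • ((1 : ℂ), z) := by
  set k : ℝ := √(1 - ‖z‖ ^ 2) with hk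
  have hpos : 0 < 1 - ‖z‖ ^ 2 := by nlinarith [norm_nonneg z]
  have hk0 : 0 < k := Real.sqrt_pos.2 hpos
  have hk2 : k ^ 2 = 1 - ‖z‖ ^ 2 := Real.sq_sqrt hpos.le
  have hkC : (k : ℂ) ≠ 0 := by exact_mod_cast hk0.ne'
  set x : ℂ × C2 := (1, 0)
  set y : ℂ × C2 := ((k⁻¹ : ℝ) : ℂ) • ((1 : ℂ), z) with hy
  have hxx : form x x = -1 := by simp [form_apply, x]
  have hxy : form x y = -(k : ℂ)⁻¹ := by simp [form_apply, x, y]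
  have hyx : form y x = -(k : ℂ)⁻¹ := by simp [form_apply, x, y]
  have hyy : form y y = -1 := by
    rw [form_self, hy, quad_smul, Complex.norm_real, Real.norm_eq_abs, sq_abs, quad, norm_one]
    have : (k⁻¹) ^ 2 * (‖z‖ ^ 2 - 1 ^ 2) = -1 := by
      rw [inv_pow, hk2]
      field_simp
      ring
    rw [this]
    simp
  have hvv : form (x - y) (x - y) = -2 + 2 * (k : ℂ)⁻¹ := by
    simp [hxx, hxy, hyx, hyy]
    ring
  have hvx : form (x - y) x = -1 + (k : ℂ)⁻¹ := by
    simp [hxx, hyx]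
  refine ⟨x - y, ((k⁻¹ : ℝ) : ℂ), by exact_mod_cast inv_ne_zero hk0.ne', ?_⟩
  rw [← hy, reflect_apply, hvv, hvx]
  by_cases h1 : (k : ℂ)⁻¹ = 1
  · have hk1 : k = 1 := by
      have : (k : ℂ) = 1 := inv_eq_one.1 h1
      exact_mod_cast this
    have hz0 : z = 0 := by
      rw [hk1] at hk2
      have : ‖z‖ ^ 2 = 0 := by linarith
      simpa using this
    have hxy' : x = y := by simp [x, y, hk1, hz0]
    simp [← hxy']
  · have h2 : -1 + (k : ℂ)⁻¹ ≠ 0 := fun h => h1 (by linear_combination h)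
    have h3 : 2 / (-2 + 2 * (k : ℂ)⁻¹) * (-1 + (k : ℂ)⁻¹) = 1 := by
      have : -2 + 2 * (k : ℂ)⁻¹ = 2 * (-1 + (k : ℂ)⁻¹) := by ring
      rw [this, ← div_div, div_self two_ne_zero, one_div, inv_mul_cancel₀ h2]
    rw [h3, one_smul, sub_sub_cancel]

open Metric in
/-- Cartan's theorem for the ball: an automorphism fixing the origin is linear and isometric, by the
equality case of the Schwarz lemma on the lines through the origin. -/
theorem exists_linearIsometry_of_fixes_zero {f g : C2 → C2} (hf : DifferentiableOn ℂ f (ball 0 1))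
    (hg : DifferentiableOn ℂ g (ball 0 1)) (hfm : Set.MapsTo f (ball 0 1) (ball 0 1))
    (hgm : Set.MapsTo g (ball 0 1) (ball 0 1)) (hgf : ∀ z ∈ ball (0 : C2) 1, g (f z) = z)
    (h0 : f 0 = 0) : ∃ U : C2 →ₗᵢ[ℂ] C2, ∀ z ∈ ball (0 : C2) 1, f z = U z := by
  have hmem : (0 : C2) ∈ ball (0 : C2) 1 := by simp
  have hg0 : g 0 = 0 := by simpa [h0] using hgf 0 hmem
  have hnorm : ∀ z ∈ ball (0 : C2) 1, ‖f z‖ = ‖z‖ := by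
    intro z hz
    refine le_antisymm (Complex.norm_le_norm_of_mapsTo_ball hf
      (hfm.mono_right ball_subset_closedBall) h0 (by simpa using hz)) ?_
    have h1 := Complex.norm_le_norm_of_mapsTo_ball hg
      (hgm.mono_right ball_subset_closedBall) hg0 (z := f z) (by simpa using hfm hz)
    rwa [hgf z hz] at h1
  set T := fderiv ℂ f 0 with hT
  have hfT : ∀ z ∈ ball (0 : C2) 1, f z = T z := by
    intro z hz
    rcases eq_or_ne z 0 with rfl | hz0
    · simp [h0]
    have hzn : 0 < ‖z‖ := norm_pos_iff.2 hz0
    have hznC : (‖z‖ : ℂ) ≠ 0 := by exact_mod_cast hzn.ne'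
    set u : C2 := (‖z‖ : ℂ)⁻¹ • z with hu
    have hun : ‖u‖ = 1 := by simp [hu, norm_smul, hzn.ne']
    have hzu : z = (‖z‖ : ℂ) • u := by rw [hu, smul_smul, mul_inv_cancel₀ hznC, one_smul]
    have hmaps : Set.MapsTo (fun t : ℂ => t • u) (ball 0 1) (ball 0 1) := fun t ht => by
      simpa [norm_smul, hun] using ht
    set h : ℂ → C2 := fun t => f (t • u) with hh
    have hhd : DifferentiableOn ℂ h (ball 0 1) :=
      hf.comp (by fun_prop) hmaps
    have hh0 : h 0 = 0 := by simp [hh, h0]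
    have hhm : Set.MapsTo h (ball 0 1) (closedBall (h 0) 1) := by
      rw [hh0]
      exact (hfm.comp hmaps).mono_right ball_subset_closedBall
    have ht0 : (‖z‖ : ℂ) ∈ ball (0 : ℂ) 1 := by simpa using hz
    have hslope : ‖dslope h 0 (‖z‖ : ℂ)‖ = 1 / 1 := by
      rw [dslope_of_ne _ hznC, slope_def_module, hh0, sub_zero, sub_zero, norm_smul, hh]
      simp only
      rw [← hzu, hnorm z hz]
      simp [hzn.ne']
    have haff := Complex.affine_of_mapsTo_ball_of_norm_dslope_eq_div hhd hhm ht0 hslope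
    set w := dslope h 0 (‖z‖ : ℂ)
    have haff' : ∀ t ∈ ball (0 : ℂ) 1, h t = t • w := fun t ht => by
      simpa [hh0] using haff ht
    have hd1 : HasDerivAt h w 0 := by
      have h1 : HasDerivAt (fun t : ℂ => t • w) w 0 := by
        simpa using (hasDerivAt_id (0 : ℂ)).smul_const w
      refine h1.congr_of_eventuallyEq ?_
      filter_upwards [isOpen_ball.mem_nhds (mem_ball_self one_pos)] with t ht using haff' t ht
    have hd2 : HasDerivAt h (T u) 0 := by
      have h1 : HasFDerivAt f T ((0 : ℂ) • u) := by
        rw [zero_smul]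
        exact (hf.differentiableAt (isOpen_ball.mem_nhds hmem)).hasFDerivAt
      have h2 : HasDerivAt (fun t : ℂ => t • u) u 0 := by
        simpa using (hasDerivAt_id (0 : ℂ)).smul_const u
      exact h1.comp_hasDerivAt (0 : ℂ) h2
    have hwT := hd1.unique hd2
    calc f z = h (‖z‖ : ℂ) := by rw [hh]; simp only; rw [← hzu]
      _ = (‖z‖ : ℂ) • w := haff' _ ht0
      _ = T ((‖z‖ : ℂ) • u) := by rw [hwT]; exact (T.map_smul _ _).symm
      _ = T z := by rw [← hzu]
  refine ⟨⟨(T : C2 →ₗ[ℂ] C2), fun z => ?_⟩, hfT⟩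
  rcases eq_or_ne z 0 with rfl | hz0
  · simp
  have hzn : 0 < ‖z‖ := norm_pos_iff.2 hz0
  set k : ℂ := (((2 * ‖z‖)⁻¹ : ℝ) : ℂ) with hk
  have hkn : ‖k‖ = (2 * ‖z‖)⁻¹ := by
    rw [hk, Complex.norm_real, Real.norm_eq_abs, abs_of_pos (by positivity)]
  have hkz : k • z ∈ ball (0 : C2) 1 := by
    rw [mem_ball_zero_iff, norm_smul, hkn]
    field_simp
    norm_num
  have h1 := hnorm _ hkz
  rw [hfT _ hkz, map_smul, norm_smul, norm_smul] at h1
  exact mul_left_cancel₀ (by rw [hkn]; positivity) h1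

/-- A linear isometry of the Hermitian form inducing a given map of the ball. -/
structure IsLift (A : (ℂ × C2) →ₗ[ℂ] (ℂ × C2)) (φ : unitBall → unitBall) : Prop where
  isometry : IsFormIsometry A
  eq_smul : ∀ z : unitBall, ∃ a : ℂ, a ≠ 0 ∧ A (1, z) = a • ((1 : ℂ), (φ z : C2))

/-- Every automorphism of the ball is induced by an isometry of the Hermitian form. -/
theorem exists_isLift (φ : holAut) : ∃ A, IsLift A (φ : Equiv.Perm unitBall) := by
  obtain ⟨φ, hφ, hφ'⟩ := φ
  set Φ := coordMap φ with hΦ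
  set Ψ := coordMap φ.symm with hΨ
  obtain ⟨v, a, ha, hv⟩ := exists_reflect_origin (norm_coordMap_lt φ 0)
  set R := reflect v
  have hR : IsFormIsometry R := isFormIsometry_reflect v
  have hRmaps : Set.MapsTo (affineMap R) (Metric.ball 0 1) (Metric.ball 0 1) := fun z hz => by
    rw [mem_ball_zero_iff] at hz ⊢
    exact hR.norm_affineMap_lt hz
  have hRR : ∀ z : C2, ‖z‖ < 1 → R (1, affineMap R z) = (R (1, z)).1⁻¹ • ((1 : ℂ), z) := by
    intro z hz
    have h1 := congrArg R (hR.eq_smul_affineMap hz)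
    rw [reflect_reflect, map_smul] at h1
    exact (eq_inv_smul_iff₀ (hR.fst_ne_zero hz)).2 h1.symm
  have hRR' : ∀ z : C2, ‖z‖ < 1 → affineMap R (affineMap R z) = z := fun z hz =>
    affineMap_eq_of_smul (inv_ne_zero (hR.fst_ne_zero hz)) (hRR z hz)
  have hΦm : Set.MapsTo Φ (Metric.ball 0 1) (Metric.ball 0 1) := fun z _ =>
    mem_ball_zero_iff.2 (norm_coordMap_lt φ z)
  have hΨm : Set.MapsTo Ψ (Metric.ball 0 1) (Metric.ball 0 1) := fun z _ =>
    mem_ball_zero_iff.2 (norm_coordMap_lt φ.symm z)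
  obtain ⟨U, hU⟩ := exists_linearIsometry_of_fixes_zero (f := affineMap R ∘ Φ)
    (g := Ψ ∘ affineMap R)
    (hR.differentiableOn_affineMap.comp (differentiableOn_coordMap hφ) hΦm)
    ((differentiableOn_coordMap hφ').comp hR.differentiableOn_affineMap hRmaps)
    (hRmaps.comp hΦm) (hΨm.comp hRmaps) (fun z hz => by
      rw [mem_ball_zero_iff] at hz
      change coordMap φ.symm (affineMap R (affineMap R (coordMap φ z))) = z
      rw [hRR' _ (norm_coordMap_lt φ z), coordMap, coordMap, toBall_coe,
        Equiv.symm_apply_apply, coe_toBall hz]) (by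
      simp only [Function.comp_apply]
      have h1 : R (1, Φ 0) = a⁻¹ • ((1 : ℂ), (0 : C2)) := by
        have h2 := congrArg R hv
        rw [reflect_reflect, map_smul] at h2
        rw [h2, smul_smul, inv_mul_cancel₀ ha, one_smul]
      exact affineMap_eq_of_smul (inv_ne_zero ha) h1)
  refine ⟨R ∘ₗ (LinearMap.id.prodMap U.toLinearMap), ?_, fun z => ?_⟩
  · intro x y
    rw [LinearMap.comp_apply, LinearMap.comp_apply, hR]
    simp [form_apply]
  · have hz := norm_coe_unitBall z
    have hφz := norm_coe_unitBall (φ z)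
    refine ⟨(R (1, (φ z : C2))).1⁻¹, inv_ne_zero (hR.fst_ne_zero hφz), ?_⟩
    have h1 : U (z : C2) = affineMap R (φ z) := by
      rw [← hU z (mem_ball_zero_iff.2 hz), Function.comp_apply, hΦ, coordMap_coe]
    have h2 : (LinearMap.id.prodMap U.toLinearMap) ((1 : ℂ), (z : C2)) =
        ((1 : ℂ), affineMap R (φ z)) := by
      rw [← h1]
      rfl
    rw [LinearMap.comp_apply, h2, hRR _ hφz]

/-! ### Lifting discs from the quotient to the ball -/

section Quotient

open BallQuotient

variable (Γ : Subgroup holAut)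

theorem isCoveringMap_proj [h : IsKleinian Γ] : IsCoveringMap (proj Γ) := by
  have hq : IsQuotientCoveringMap (proj Γ) Γ :=
    { toIsQuotientMap := isQuotientMap_quotient_mk'
      toContinuousConstSMul := ⟨fun φ => (contMDiff_smul Γ φ).continuous⟩
      apply_eq_iff_mem_orbit := Quotient.eq''
      disjoint := fun z => by
        obtain ⟨U, hU, hz, H⟩ := h.exists_nhd z
        exact ⟨U, hU.mem_nhds hz, fun φ hφ => Subtype.ext (H φ.1 φ.2 hφ)⟩ }
  exact hq.isCoveringMap

variable {Γ}

theorem proj_smul (φ : Γ) (z : unitBall) : proj Γ (φ • z) = proj Γ z :=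
  (proj_eq_iff Γ).2 ⟨φ, rfl⟩

variable [IsKleinian Γ]

/-- The local inverses of the projection that define the charts of the quotient are holomorphic. -/
theorem contMDiffAt_localInverseAt (q : BallQuotient Γ) :
    ContMDiffAt 𝓘(ℂ, C2) 𝓘(ℂ, C2) ω
      ((isLocalHomeomorph_proj Γ).localInverseAt
        ((proj_surjective Γ).hasRightInverse.choose q)) q := by
  set a := (proj_surjective Γ).hasRightInverse.choose q with ha
  set e := chartAt C2 q with he
  have h1 : ContMDiffAt 𝓘(ℂ, C2) 𝓘(ℂ, C2) ω e q :=
    contMDiffOn_chart.contMDiffAt (e.open_source.mem_nhds (mem_chart_source C2 q))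
  have hqe : q ∈ e.source := mem_chart_source C2 q
  have h2 : ContMDiffAt 𝓘(ℂ, C2) 𝓘(ℂ, C2) ω (chartAt C2 a).symm (e q) := by
    refine contMDiffOn_chart_symm.contMDiffAt ((chartAt C2 a).open_target.mem_nhds ?_)
    exact (chartAt C2 a).map_source hqe.2
  refine (h2.comp q h1).congr_of_eventuallyEq ?_
  filter_upwards [e.open_source.mem_nhds hqe] with p hp
  exact ((chartAt C2 a).left_inv hp.2).symm

/-- The projection `𝔹² → 𝔹² / Γ` has a holomorphic local section through each point. -/
theorem exists_local_section (y : unitBall) : ∃ S : BallQuotient Γ → unitBall,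
    ContMDiffAt 𝓘(ℂ, C2) 𝓘(ℂ, C2) ω S (proj Γ y) ∧ ∀ᶠ z in 𝓝 y, S (proj Γ z) = z := by
  have hl := isLocalHomeomorph_proj Γ
  set a := (proj_surjective Γ).hasRightInverse.choose (proj Γ y) with ha
  set L := hl.localInverseAt a with hL
  have hys : proj Γ y ∈ L.source := (mem_chart_source C2 (proj Γ y)).1
  obtain ⟨φ, hφ⟩ := (proj_eq_iff Γ).1 (hl.apply_localInverseAt_of_mem hys)
  refine ⟨fun p => φ⁻¹ • L p,
    ((contMDiff_smul Γ φ⁻¹) _).comp _ (contMDiffAt_localInverseAt _), ?_⟩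
  have h1 : ∀ᶠ z in 𝓝 y, φ • z ∈ L.target := by
    refine (contMDiff_smul Γ φ).continuous.continuousAt.eventually_mem
      (L.open_target.mem_nhds ?_)
    rw [hφ]
    exact L.map_source hys
  have h2 : ∀ᶠ z in 𝓝 y, proj Γ z ∈ L.source :=
    hl.continuous.continuousAt.eventually_mem (L.open_source.mem_nhds hys)
  filter_upwards [h1, h2] with z hz1 hz2
  rw [inv_smul_eq_iff]
  refine hl.injOn_localInverseAt_target (L.map_source hz2) hz1 ?_
  rw [hl.apply_localInverseAt_of_mem hz2, proj_smul]

theorem contMDiff_proj : ContMDiff 𝓘(ℂ, C2) 𝓘(ℂ, C2) ω (proj Γ) := by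
  intro y
  have hl := isLocalHomeomorph_proj Γ
  set q := proj Γ y with hq
  set a := (proj_surjective Γ).hasRightInverse.choose q with ha
  set L := hl.localInverseAt a with hL
  set e := chartAt C2 q with he
  have hqe : q ∈ e.source := mem_chart_source C2 q
  obtain ⟨φ, hφ⟩ := (proj_eq_iff Γ).1 (hl.apply_localInverseAt_of_mem hqe.1)
  have hφa : φ • y ∈ (chartAt C2 a).source := by
    rw [hφ]
    exact hqe.2
  have hdt : chartAt C2 a (φ • y) = e q := by rw [hφ]; rfl
  have h1 : ContMDiffAt 𝓘(ℂ, C2) 𝓘(ℂ, C2) ω (fun z => chartAt C2 a (φ • z)) y :=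
    (contMDiffOn_chart.contMDiffAt ((chartAt C2 a).open_source.mem_nhds hφa)).comp y
      ((contMDiff_smul Γ φ) y)
  have h2 : ContMDiffAt 𝓘(ℂ, C2) 𝓘(ℂ, C2) ω e.symm (chartAt C2 a (φ • y)) := by
    rw [hdt]
    exact contMDiffOn_chart_symm.contMDiffAt (e.open_target.mem_nhds (e.map_source hqe))
  refine (h2.comp y h1).congr_of_eventuallyEq ?_
  have h3 : ∀ᶠ z in 𝓝 y, φ • z ∈ (chartAt C2 a).source :=
    (contMDiff_smul Γ φ).continuous.continuousAt.eventually_mem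
      ((chartAt C2 a).open_source.mem_nhds hφa)
  filter_upwards [h3] with z hz
  have h4 : e.symm (chartAt C2 a (φ • z)) = L.symm ((chartAt C2 a).symm (chartAt C2 a (φ • z))) :=
    rfl
  rw [Function.comp_apply, h4, (chartAt C2 a).left_inv hz, hL, hl.localInverseAt_symm, proj_smul]

open Metric in
theorem exists_continuous_lift {f : ℂ → BallQuotient Γ} (hf : ContinuousOn f (ball 0 1))
    {y : unitBall} (hy : proj Γ y = f 0) :
    ∃ g : ℂ → unitBall, ContinuousOn g (ball 0 1) ∧ g 0 = y ∧
      ∀ t ∈ ball (0 : ℂ) 1, proj Γ (g t) = f t := by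
  classical
  have : ContractibleSpace (ball (0 : ℂ) 1) :=
    (convex_ball (0 : ℂ) 1).contractibleSpace ⟨0, mem_ball_self one_pos⟩
  have : LocallyPathConnectedSpace (ball (0 : ℂ) 1) := isOpen_ball.locallyPathConnectedSpace
  obtain ⟨G, ⟨hG0, hG⟩, -⟩ := (isCoveringMap_proj Γ).existsUnique_continuousMap_lifts
    (A := ball (0 : ℂ) 1) ⟨fun t => f t, continuousOn_iff_continuous_domRestrict.1 hf⟩
    ⟨0, mem_ball_self one_pos⟩ y hy
  refine ⟨fun t => if h : t ∈ ball (0 : ℂ) 1 then G ⟨t, h⟩ else y, ?_, ?_, ?_⟩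
  · rw [continuousOn_iff_continuous_domRestrict]
    convert G.continuous using 1
    ext1 t
    simp only [Set.domRestrict_apply, dif_pos t.2]
  · simp only [dif_pos (mem_ball_self (one_pos : (0 : ℝ) < 1)), hG0]
  · intro t ht
    simp only [dif_pos ht]
    exact congrFun hG ⟨t, ht⟩

theorem mdifferentiableAt_of_contMDiffOn {X : Type*} [TopologicalSpace X] [ChartedSpace C2 X]
    {f : ℂ → X} (hf : ContMDiffOn 𝓘(ℂ, ℂ) 𝓘(ℂ, C2) ω f (Metric.ball 0 1)) {t : ℂ}
    (ht : t ∈ Metric.ball (0 : ℂ) 1) : MDifferentiableAt 𝓘(ℂ, ℂ) 𝓘(ℂ, C2) f t :=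
  (hf.contMDiffAt (Metric.isOpen_ball.mem_nhds ht)).mdifferentiableAt (by simp)

open Metric in
/-- Let `F` be a holomorphic disc in the ball. A disc `f` in the quotient with initial vector `r`
times that of the projection of `F` lifts to a holomorphic disc in the ball with initial vector
`r F'(0)`. -/
theorem exists_holomorphic_lift {F : ℂ → unitBall}
    (hF : ContMDiffOn 𝓘(ℂ, ℂ) 𝓘(ℂ, C2) ω F (ball 0 1)) {f : ℂ → BallQuotient Γ} {r : ℝ}
    (hf : IsHolDiscAlong C2 (BallQuotient Γ) f
      (tangentMap 𝓘(ℂ, ℂ) 𝓘(ℂ, C2) (proj Γ ∘ F) ⟨0, (1 : ℂ)⟩) r) :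
    ∃ g : ℂ → unitBall, DifferentiableOn ℂ (fun t => (g t : C2)) (ball 0 1) ∧ g 0 = F 0 ∧
      deriv (fun t => (g t : C2)) 0 = (r : ℂ) • deriv (fun t => (F t : C2)) 0 ∧
      ∀ t ∈ ball (0 : ℂ) 1, proj Γ (g t) = f t := by
  obtain ⟨hfd, hft⟩ := hf
  have h0 : (0 : ℂ) ∈ ball (0 : ℂ) 1 := mem_ball_self one_pos
  have hf0 : proj Γ (F 0) = f 0 := (congrArg (fun p => p.proj) hft).symm
  obtain ⟨g, hgc, hg0, hgf⟩ := exists_continuous_lift hfd.continuousOn hf0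
  have hsec : ∀ t ∈ ball (0 : ℂ) 1, ∃ S : BallQuotient Γ → C2,
      ContMDiffAt 𝓘(ℂ, C2) 𝓘(ℂ, C2) ω S (f t) ∧ (∀ᶠ z in 𝓝 (g t), S (proj Γ z) = z) ∧
        ∀ᶠ s in 𝓝 t, (g s : C2) = S (f s) := by
    intro t ht
    obtain ⟨S, hS, hS'⟩ := exists_local_section (Γ := Γ) (g t)
    refine ⟨fun p => S p, ?_, ?_, ?_⟩
    · rw [hgf t ht] at hS
      exact contMDiff_subtype_val.contMDiffAt.comp _ hS
    · filter_upwards [hS'] with z hz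
      rw [hz]
    · filter_upwards [(hgc.continuousAt (isOpen_ball.mem_nhds ht)).eventually hS',
        isOpen_ball.mem_nhds ht] with s hs hs1
      rw [← hgf s hs1, hs]
  refine ⟨g, fun t ht => ?_, hg0, ?_, hgf⟩
  · obtain ⟨S, hS, -, hS'⟩ := hsec t ht
    have h1 : MDifferentiableAt 𝓘(ℂ, ℂ) 𝓘(ℂ, C2) (fun s => S (f s)) t :=
      (hS.mdifferentiableAt (by simp)).comp t (mdifferentiableAt_of_contMDiffOn hfd ht)
    have h2 : DifferentiableAt ℂ (fun s => S (f s)) t := mdifferentiableAt_iff_differentiableAt.1 h1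
    exact (h2.congr_of_eventuallyEq hS').differentiableWithinAt
  · obtain ⟨S, hS, hSz, hS'⟩ := hsec 0 h0
    have hSd : MDifferentiableAt 𝓘(ℂ, C2) 𝓘(ℂ, C2) S (f 0) := hS.mdifferentiableAt (by simp)
    have hFm := mdifferentiableAt_of_contMDiffOn hF h0
    have hπF : MDifferentiableAt 𝓘(ℂ, ℂ) 𝓘(ℂ, C2) (proj Γ ∘ F) 0 :=
      (contMDiff_proj.contMDiffAt.mdifferentiableAt (by simp)).comp 0 hFm
    have hfm := mdifferentiableAt_of_contMDiffOn hfd h0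
    have hF' : ∀ᶠ s in 𝓝 (0 : ℂ), (F s : C2) = (S ∘ (proj Γ ∘ F)) s := by
      rw [hg0] at hSz
      filter_upwards [hFm.continuousAt.eventually hSz] with s hs
      exact hs.symm
    have hSd' : MDifferentiableAt 𝓘(ℂ, C2) 𝓘(ℂ, C2) S ((proj Γ ∘ F) 0) := by
      rw [Function.comp_apply, hf0]
      exact hSd
    have e1 := tangentMap_comp_at (I := 𝓘(ℂ, ℂ)) (I' := 𝓘(ℂ, C2)) (I'' := 𝓘(ℂ, C2)) (f := f)
      (g := S) ⟨0, (1 : ℂ)⟩ hSd hfm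
    have e2 := tangentMap_comp_at (I := 𝓘(ℂ, ℂ)) (I' := 𝓘(ℂ, C2)) (I'' := 𝓘(ℂ, C2))
      (f := proj Γ ∘ F) (g := S) ⟨0, (1 : ℂ)⟩ hSd' hπF
    have e3 : (tangentMap 𝓘(ℂ, ℂ) 𝓘(ℂ, C2) (S ∘ f) ⟨0, (1 : ℂ)⟩).2 =
        (r : ℂ) • (tangentMap 𝓘(ℂ, ℂ) 𝓘(ℂ, C2) (S ∘ (proj Γ ∘ F)) ⟨0, (1 : ℂ)⟩).2 := by
      rw [e1, e2, hft]
      exact (mfderiv 𝓘(ℂ, C2) 𝓘(ℂ, C2) S (proj Γ (F 0))).map_smul (r : ℂ) _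
    simp only [tangentMap, mfderiv_eq_fderiv] at e3
    rw [Filter.EventuallyEq.deriv_eq (f := fun s => S (f s)) hS', Filter.EventuallyEq.deriv_eq hF']
    exact e3

end Quotient

/-! ### Compact quotients: all nontrivial elements are loxodromic -/

section Kleinian

variable {Γ : Subgroup holAut} [h : IsKleinian Γ]

theorem eq_one_of_smul_eq {φ : holAut} (hφ : φ ∈ Γ) {z : unitBall} (hz : φ • z = z) : φ = 1 := by
  obtain ⟨U, -, hzU, H⟩ := h.exists_nhd z
  exact H φ hφ ⟨z, ⟨z, hzU, hz⟩, hzU⟩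

theorem not_compactSpace_unitBall : ¬ CompactSpace unitBall := by
  intro hc
  have h1 : IsClosed (Metric.ball (0 : C2) 1) := (isCompact_iff_compactSpace.2 hc).isClosed
  have h2 : EuclideanSpace.single (0 : Fin 2) (1 : ℂ) ∈ Metric.ball (0 : C2) 1 := by
    rw [← h1.closure_eq, closure_ball _ one_ne_zero]
    simp
  simp at h2

theorem exists_ne_one_of_compactSpace [CompactSpace (BallQuotient Γ)] : ∃ φ ∈ Γ, φ ≠ 1 := by
  by_contra hc
  push Not at hc
  have hl := BallQuotient.isLocalHomeomorph_proj Γ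
  have hinj : Function.Injective (BallQuotient.proj Γ) := by
    intro y z hyz
    obtain ⟨φ, hφ⟩ := (BallQuotient.proj_eq_iff Γ).1 hyz
    have : φ = 1 := Subtype.ext (hc φ.1 φ.2)
    rw [← hφ, this, one_smul]
  have hbij : Function.Bijective (BallQuotient.proj Γ) := ⟨hinj, BallQuotient.proj_surjective Γ⟩
  have e := (Equiv.ofBijective _ hbij).toHomeomorphOfContinuousOpen hl.continuous hl.isOpenMap
  exact not_compactSpace_unitBall e.symm.compactSpace

end Kleinian

/-- `z` and `w` are close in the hyperbolic metric of the ball: the cross ratio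
`(1 - ‖z‖²) (1 - ‖w‖²) / |1 - ⟪z, w⟫|²` is at least `1 - ε`. -/
def IsHypClose (ε : ℝ) (z w : unitBall) : Prop :=
  (1 - ε) * ‖form ((1 : ℂ), (z : C2)) ((1 : ℂ), (w : C2))‖ ^ 2 ≤
    quad ((1 : ℂ), (z : C2)) * quad ((1 : ℂ), (w : C2))

theorem isHypClose_smul (g : holAut) {ε : ℝ} {z w : unitBall} (hzw : IsHypClose ε z w) :
    IsHypClose ε (g • z) (g • w) := by
  obtain ⟨A, hA, hlift⟩ := exists_isLift g
  obtain ⟨a, ha, haz⟩ := hlift z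
  obtain ⟨b, hb, hbw⟩ := hlift w
  have hz : quad ((1 : ℂ), (z : C2)) = ‖a‖ ^ 2 * quad ((1 : ℂ), ((g • z : unitBall) : C2)) := by
    rw [← hA.quad_eq, haz, quad_smul]
    rfl
  have hw : quad ((1 : ℂ), (w : C2)) = ‖b‖ ^ 2 * quad ((1 : ℂ), ((g • w : unitBall) : C2)) := by
    rw [← hA.quad_eq, hbw, quad_smul]
    rfl
  have hf : ‖form ((1 : ℂ), (z : C2)) ((1 : ℂ), (w : C2))‖ = ‖a‖ * ‖b‖ *
      ‖form ((1 : ℂ), ((g • z : unitBall) : C2)) ((1 : ℂ), ((g • w : unitBall) : C2))‖ := by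
    rw [← hA, haz, hbw]
    simp only [map_smulₛₗ, LinearMap.smul_apply, smul_eq_mul, norm_mul, RCLike.norm_conj,
      RingHom.id_apply]
    rw [mul_comm ‖a‖ ‖b‖, mul_assoc]
    rfl
  unfold IsHypClose at hzw ⊢
  rw [hz, hw, hf] at hzw
  have hpos : 0 < ‖a‖ ^ 2 * ‖b‖ ^ 2 := by
    have := norm_pos_iff.2 ha
    have := norm_pos_iff.2 hb
    positivity
  refine le_of_mul_le_mul_left ?_ hpos
  linarith

/-- Hyperbolically close points are close in the Euclidean metric, uniformly on compact sets. -/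
theorem IsHypClose.norm_sub_sq_le {ε : ℝ} (hε : 0 ≤ ε) {z w : unitBall} (hzw : IsHypClose ε z w) :
    (1 - ‖(z : C2)‖ ^ 2) * ‖(z : C2) - w‖ ^ 2 ≤ 4 * ε := by
  set s : ℂ := inner ℂ (z : C2) (w : C2) with hs
  have hz := norm_coe_unitBall z
  have hw := norm_coe_unitBall w
  have hzn := norm_nonneg (z : C2)
  have hwn := norm_nonneg (w : C2)
  have hf : form ((1 : ℂ), (z : C2)) ((1 : ℂ), (w : C2)) = s - 1 := by simp [form_apply, hs]
  have hsn : ‖s‖ ≤ 1 := (norm_inner_le_norm _ _).trans (mul_le_one₀ hz.le hwn hw.le)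
  have hs1 : ‖s - 1‖ ^ 2 = ‖s‖ ^ 2 - 2 * s.re + 1 := by
    rw [← Complex.normSq_eq_norm_sq, ← Complex.normSq_eq_norm_sq, Complex.normSq_apply,
      Complex.normSq_apply]
    simp
    ring
  have hs2 : ‖s - 1‖ ≤ 2 := (norm_sub_le _ _).trans (by rw [norm_one]; linarith)
  have hs3 : ‖s - 1‖ ^ 2 ≤ 4 := by nlinarith [norm_nonneg (s - 1)]
  have hsub : ‖(z : C2) - w‖ ^ 2 = ‖(z : C2)‖ ^ 2 - 2 * s.re + ‖(w : C2)‖ ^ 2 := by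
    rw [norm_sub_sq (𝕜 := ℂ)]
    rfl
  have hre : s.re ^ 2 ≤ ‖s‖ ^ 2 := by
    rw [← Complex.normSq_eq_norm_sq, Complex.normSq_apply]
    nlinarith [mul_self_nonneg s.im]
  unfold IsHypClose at hzw
  rw [hf] at hzw
  simp only [quad, norm_one] at hzw
  rw [hsub]
  have h1 : ε * ‖s - 1‖ ^ 2 ≤ ε * 4 := by gcongr
  nlinarith [sq_nonneg (‖(z : C2)‖ ^ 2 - s.re)]

section Kleinian

variable {Γ : Subgroup holAut} [h : IsKleinian Γ]

/-- In a compact quotient, the hyperbolic displacements of a nontrivial element are bounded away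
from zero: otherwise, translates of points of small displacement accumulate in the ball, and
conjugates of the element violate proper discontinuity there. -/
theorem exists_forall_not_isHypClose [CompactSpace (BallQuotient Γ)] {φ : holAut} (hφ : φ ∈ Γ)
    (hφ1 : φ ≠ 1) : ∃ ε, 0 < ε ∧ ε ≤ 1 ∧ ∀ z : unitBall, ¬ IsHypClose ε z (φ • z) := by
  by_contra hc
  push Not at hc
  have hεn : ∀ n : ℕ, (0 : ℝ) < 1 / ((n : ℝ) + 1) ∧ 1 / ((n : ℝ) + 1) ≤ 1 := fun n =>
    ⟨by positivity, by
      rw [div_le_one (by positivity)]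
      linarith [(Nat.cast_nonneg n : (0 : ℝ) ≤ n)]⟩
  choose z hz using fun n : ℕ => hc (1 / ((n : ℝ) + 1)) (hεn n).1 (hεn n).2
  obtain ⟨q, hq⟩ := exists_clusterPt_of_compactSpace
    (Filter.map (fun n => BallQuotient.proj Γ (z n)) Filter.atTop)
  obtain ⟨w, rfl⟩ := BallQuotient.proj_surjective Γ q
  obtain ⟨U, hU, hwU, H⟩ := h.exists_nhd w
  obtain ⟨d₀, hd₀, hdU⟩ := Metric.isOpen_iff.1 hU w hwU
  have hw := norm_coe_unitBall w
  set d := min (d₀ / 2) ((1 - ‖(w : C2)‖) / 2) with hd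
  have hd0 : 0 < d := lt_min (by linarith) (by linarith)
  have hd1 : d ≤ d₀ / 2 := min_le_left _ _
  have hd2 : d ≤ (1 - ‖(w : C2)‖) / 2 := min_le_right _ _
  have hnhd : BallQuotient.proj Γ '' Metric.ball w d ∈ 𝓝 (BallQuotient.proj Γ w) :=
    (BallQuotient.isLocalHomeomorph_proj Γ).isOpenMap.image_mem_nhds (Metric.ball_mem_nhds w hd0)
  have hfreq : ∃ᶠ n in Filter.atTop,
      BallQuotient.proj Γ (z n) ∈ BallQuotient.proj Γ '' Metric.ball w d :=
    mapClusterPt_iff_frequently.1 hq _ hnhd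
  have hlim : ∀ᶠ n : ℕ in Filter.atTop, 1 / ((n : ℝ) + 1) < d * d ^ 2 / 4 :=
    tendsto_one_div_add_atTop_nhds_zero_nat.eventually (gt_mem_nhds (by positivity))
  obtain ⟨n, ⟨y, hyw, hyz⟩, hn⟩ := (hfreq.and_eventually hlim).exists
  obtain ⟨g, hg⟩ := (BallQuotient.proj_eq_iff Γ).1 hyz
  have hclose : IsHypClose (1 / ((n : ℝ) + 1)) y ((g : holAut) • φ • z n) := by
    rw [← hg]
    exact isHypClose_smul g.1 (hz n)
  have hle := hclose.norm_sub_sq_le (hεn n).1.le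
  have hyw' : ‖(y : C2) - w‖ < d := by rw [← dist_eq_norm]; exact hyw
  have hyn : ‖(y : C2)‖ ≤ 1 - d := by
    have := norm_le_norm_add_norm_sub' (y : C2) (w : C2)
    linarith
  have hdist : ‖(y : C2) - ((g : holAut) • φ • z n : unitBall)‖ < d := by
    have h1 : d ≤ 1 - ‖(y : C2)‖ ^ 2 := by nlinarith [norm_nonneg (y : C2)]
    have h2 : d * ‖(y : C2) - ((g : holAut) • φ • z n : unitBall)‖ ^ 2 < d * d ^ 2 := by
      have := mul_le_mul_of_nonneg_right h1
        (sq_nonneg ‖(y : C2) - ((g : holAut) • φ • z n : unitBall)‖)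
      linarith
    exact lt_of_pow_lt_pow_left₀ 2 hd0.le (lt_of_mul_lt_mul_left h2 hd0.le)
  have hyU : y ∈ U := hdU (Metric.mem_ball.2 ((Metric.mem_ball.1 hyw).trans_le (by linarith)))
  have hgU : (g : holAut) • φ • z n ∈ U := by
    apply hdU
    rw [Metric.mem_ball]
    have h1 : dist ((g : holAut) • φ • z n) y < d := by
      rw [dist_comm, Subtype.dist_eq, dist_eq_norm]
      exact hdist
    have h2 := dist_triangle ((g : holAut) • φ • z n) y w
    have h3 := Metric.mem_ball.1 hyw
    linarith
  have hconj : (g : holAut) * φ * (g : holAut)⁻¹ = 1 := by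
    refine H _ (Γ.mul_mem (Γ.mul_mem g.2 hφ) (Γ.inv_mem g.2)) ⟨_, ⟨y, hyU, ?_⟩, hgU⟩
    have hg' : y = (g : holAut) • z n := hg.symm
    simp only [hg', mul_smul, inv_smul_smul]
  exact hφ1 (conj_eq_one_iff.1 hconj)

/-- Every negative vector represents a point of the ball. -/
theorem exists_smul_one_mk {x : ℂ × C2} (hx : quad x < 0) :
    ∃ z : unitBall, ∃ a : ℂ, a ≠ 0 ∧ x = a • ((1 : ℂ), (z : C2)) := by
  have h1 := fst_ne_zero_of_quad_neg hx
  have h2 : x = x.1 • ((1 : ℂ), x.1⁻¹ • x.2) := by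
    ext1
    · simp
    · simp [smul_smul, h1]
  refine ⟨⟨x.1⁻¹ • x.2, mem_ball_zero_iff.2 (norm_lt_one_of_quad_neg ?_)⟩, x.1, h1, h2⟩
  rw [h2, quad_smul] at hx
  by_contra hc
  push Not at hc
  linarith [mul_nonneg (sq_nonneg ‖x.1‖) hc]

/-- In a compact quotient, every nontrivial element has a cyclic vector in the ball: a point `z`
such that `z`, `φ z` and `φ² z` do not lie on an affine complex line. -/
theorem exists_cyclic_point [CompactSpace (BallQuotient Γ)] {φ : holAut} (hφ : φ ∈ Γ)
    (hφ1 : φ ≠ 1) {A : (ℂ × C2) →ₗ[ℂ] (ℂ × C2)} (hA : IsLift A (φ : Equiv.Perm unitBall)) :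
    ∃ z : unitBall, ∀ a b c : ℂ,
      a • ((1 : ℂ), (z : C2)) + b • A (1, (z : C2)) + c • A (A (1, (z : C2))) = 0 →
        a = 0 ∧ b = 0 ∧ c = 0 := by
  have hneg : ∀ x, quad x < 0 → ∀ α : ℂ, A x ≠ α • x := by
    intro x hx α hα
    obtain ⟨z, a, ha, rfl⟩ := exists_smul_one_mk hx
    obtain ⟨b, hb, hbz⟩ := hA.eq_smul z
    rw [map_smul, hbz, smul_comm α a] at hα
    have h1 := smul_right_injective _ ha hα
    have h2 : b = α := by simpa using congrArg Prod.fst h1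
    subst h2
    have h3 : ((φ : Equiv.Perm unitBall) z : C2) = z :=
      congrArg Prod.snd (smul_right_injective _ hb h1)
    exact hφ1 (eq_one_of_smul_eq hφ (z := z) (Subtype.ext h3))
  obtain ⟨n, hn0, hn, β, hβ⟩ := hA.isometry.exists_null_eigenvector hneg
  have hβ1 : ‖β‖ ≠ 1 := by
    intro h1
    obtain ⟨ε, hε, hε1, H⟩ := exists_forall_not_isHypClose hφ hφ1
    obtain ⟨x, hx, hxε⟩ := hA.isometry.exists_small_displacement hn0 hn hβ h1 hε hε1
    obtain ⟨z, a, ha, rfl⟩ := exists_smul_one_mk hx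
    obtain ⟨b, hb, hbz⟩ := hA.eq_smul z
    apply H z
    have hq : quad ((1 : ℂ), (z : C2)) =
        ‖b‖ ^ 2 * quad ((1 : ℂ), ((φ • z : unitBall) : C2)) := by
      rw [← hA.isometry.quad_eq, hbz, quad_smul]
      rfl
    have hf : ‖form ((1 : ℂ), (z : C2)) (A (1, (z : C2)))‖ =
        ‖b‖ * ‖form ((1 : ℂ), (z : C2)) ((1 : ℂ), ((φ • z : unitBall) : C2))‖ := by
      rw [hbz, map_smul, smul_eq_mul, norm_mul]
      rfl
    have hf' : ‖form (a • ((1 : ℂ), (z : C2))) (A (a • ((1 : ℂ), (z : C2))))‖ =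
        ‖a‖ ^ 2 * ‖form ((1 : ℂ), (z : C2)) (A (1, (z : C2)))‖ := by
      rw [LinearMap.map_smulₛₗ form, LinearMap.smul_apply, map_smul, map_smul, smul_eq_mul,
        smul_eq_mul, norm_mul, norm_mul, RCLike.norm_conj]
      ring
    rw [hf', quad_smul, hf] at hxε
    have hab : 0 < ‖a‖ ^ 4 * ‖b‖ ^ 2 := by
      have := norm_pos_iff.2 ha
      have := norm_pos_iff.2 hb
      positivity
    unfold IsHypClose
    refine le_of_mul_le_mul_left ?_ hab
    calc _ = (1 - ε) * (‖a‖ ^ 2 * (‖b‖ *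
          ‖form ((1 : ℂ), (z : C2)) ((1 : ℂ), ((φ • z : unitBall) : C2))‖)) ^ 2 := by ring
      _ ≤ _ := hxε
      _ = ‖a‖ ^ 4 * (quad ((1 : ℂ), (z : C2)) * quad ((1 : ℂ), (z : C2))) := by ring
      _ = ‖a‖ ^ 4 * (quad ((1 : ℂ), (z : C2)) *
          (‖b‖ ^ 2 * quad ((1 : ℂ), ((φ • z : unitBall) : C2)))) := by nth_rw 2 [hq]
      _ = _ := by ring
  obtain ⟨x, hx, hind⟩ := hA.isometry.exists_cyclic hn0 hn hβ hβ1
  obtain ⟨z, a, ha, rfl⟩ := exists_smul_one_mk hx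
  refine ⟨z, fun p q r hpqr => hind p q r ?_⟩
  simp only [map_smul]
  rw [smul_comm p a, smul_comm q a, smul_comm r a, ← smul_add, ← smul_add, hpqr, smul_zero]

end Kleinian

/-! ### A transversal crossing of a line with its image -/

/-- If `z`, `φ z`, `φ² z` are not collinear, then the line through `z` and `φ z` and its image under
`φ` are transversal at `φ z`. -/
theorem transversal_of_cyclic {φ : unitBall → unitBall} {A : (ℂ × C2) →ₗ[ℂ] (ℂ × C2)}
    (hA : IsLift A φ) {z : unitBall}
    (hind : ∀ a b c : ℂ,
      a • ((1 : ℂ), (z : C2)) + b • A (1, (z : C2)) + c • A (A (1, (z : C2))) = 0 →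
        a = 0 ∧ b = 0 ∧ c = 0)
    {c v : C2} {k s₀ : ℂ} (hs₀ : c + s₀ • v = z) (hk : k • v = (φ z : C2) - z)
    {x y : ℂ} (hxy : x • deriv (fun s : ℂ => coordMap φ (c + s • v)) s₀ = y • v) :
    x = 0 ∧ y = 0 := by
  set a : ℂ → C2 := fun s => coordMap φ (c + s • v) with ha
  have hz := norm_coe_unitBall z
  have hcont : ∀ᶠ s in 𝓝 s₀, ‖c + s • v‖ < 1 := by
    have h1 : Continuous fun s : ℂ => ‖c + s • v‖ := by fun_prop
    exact h1.continuousAt.eventually (gt_mem_nhds (by simp only [hs₀]; exact hz))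
  have haA : a =ᶠ[𝓝 s₀] fun s => affineMap A (c + s • v) := by
    filter_upwards [hcont] with s hs
    obtain ⟨b, hb, hbz⟩ := hA.eq_smul (toBall (c + s • v))
    rw [coe_toBall hs] at hbz
    exact (affineMap_eq_of_smul hb hbz).symm
  have hda : DifferentiableAt ℂ a s₀ := by
    refine DifferentiableAt.congr_of_eventuallyEq ?_ haA
    have h1 : DifferentiableAt ℂ (affineMap A) (c + s₀ • v) :=
      hA.isometry.differentiableOn_affineMap.differentiableAt
        (Metric.isOpen_ball.mem_nhds (by rw [hs₀]; exact z.2))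
    exact DifferentiableAt.comp (g := affineMap A) (f := fun s : ℂ => c + s • v) s₀ h1
      (by fun_prop)
  have hlin : ∀ s : ℂ, A (1, c + s • v) = A (1, c) + s • A (0, v) := by
    intro s
    rw [← map_smul, ← map_add]
    simp
  set m : ℂ → ℂ := fun s => (A (1, c + s • v)).1 with hm
  have hdA : HasDerivAt (fun s : ℂ => A (1, c + s • v)) (A (0, v)) s₀ := by
    simp only [hlin]
    simpa using ((hasDerivAt_id s₀).smul_const (A (0, v))).const_add (A (1, c))
  have hdm : HasDerivAt m (A (0, v)).1 s₀ := hdA.fst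
  have hprod : HasDerivAt (fun s => m s • ((1 : ℂ), a s))
      (m s₀ • ((0 : ℂ), deriv a s₀) + (A (0, v)).1 • ((1 : ℂ), a s₀)) s₀ :=
    hdm.smul ((hasDerivAt_const s₀ (1 : ℂ)).prodMk hda.hasDerivAt)
  have heq : (fun s : ℂ => A (1, c + s • v)) =ᶠ[𝓝 s₀] fun s => m s • ((1 : ℂ), a s) := by
    filter_upwards [hcont, haA] with s hs has
    rw [has]
    exact hA.isometry.eq_smul_affineMap hs
  have hderiv : A (0, v) = m s₀ • ((0 : ℂ), deriv a s₀) + (A (0, v)).1 • ((1 : ℂ), a s₀) :=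
    hdA.unique (hprod.congr_of_eventuallyEq heq)
  have hm0 : m s₀ ≠ 0 := hA.isometry.fst_ne_zero (by rw [hs₀]; exact hz)
  have has₀ : a s₀ = φ z := by rw [ha]; simp only; rw [hs₀, coordMap_coe]
  have hAz : A (1, (z : C2)) = m s₀ • ((1 : ℂ), (φ z : C2)) := by
    have := heq.eq_of_nhds
    simp only [hs₀, has₀] at this
    exact this
  set p := (A (0, v)).1 with hp
  have hv : k • ((0 : ℂ), v) = (m s₀)⁻¹ • A (1, (z : C2)) - ((1 : ℂ), (z : C2)) := by
    rw [hAz, inv_smul_smul₀ hm0]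
    ext1
    · simp
    · simpa using hk
  have hAv : k • A (0, v) = (m s₀)⁻¹ • A (A (1, (z : C2))) - A (1, (z : C2)) := by
    rw [← map_smul, hv, map_sub, map_smul]
  have hxy' : x • ((0 : ℂ), deriv a s₀) = y • ((0 : ℂ), v) := by
    ext1
    · simp
    · simpa using hxy
  have hφz : ((1 : ℂ), (φ z : C2)) = (m s₀)⁻¹ • A (1, (z : C2)) := by
    rw [hAz, inv_smul_smul₀ hm0]
  -- Eliminating `deriv a s₀` and `v` gives a linear relation between `z`, `A z` and `A² z`.
  have hrel : (m s₀ * y) • ((1 : ℂ), (z : C2)) +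
      (-x - x * k * p * (m s₀)⁻¹ - m s₀ * y * (m s₀)⁻¹) • A (1, (z : C2)) +
      (x * (m s₀)⁻¹) • A (A (1, (z : C2))) = 0 := by
    have h1 : x • k • A (0, v) = (m s₀ * y) • k • ((0 : ℂ), v) +
        (x * k * p) • ((1 : ℂ), (φ z : C2)) := by
      rw [hderiv, has₀, smul_add, smul_add, smul_comm k (m s₀), smul_comm x (m s₀),
        smul_comm x k ((0 : ℂ), deriv a s₀), hxy']
      module
    rw [hAv, hv, hφz] at h1
    rw [← sub_eq_zero] at h1
    rw [← h1]
    module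
  obtain ⟨h1, -, h3⟩ := hind _ _ _ hrel
  exact ⟨by simpa [hm0] using h3, by simpa [hm0] using h1⟩

/-! ### Injective discs close to the extremal disc do not exist -/

section Kleinian

open BallQuotient Metric

variable {Γ : Subgroup holAut} [IsKleinian Γ]

/-- A complex line through two points of the ball, parametrized from the midpoint `c` of its
intersection with the ball. -/
theorem exists_line_param {z w : C2} (hz : ‖z‖ < 1) (hw : ‖w‖ < 1) (hzw : z ≠ w) :
    ∃ (c u : C2) (R : ℝ) (s₀ t₀ k : ℂ), ‖u‖ = 1 ∧ inner ℂ c u = 0 ∧ 0 < R ∧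
      ‖c‖ ^ 2 + R ^ 2 = 1 ∧ ‖s₀‖ < 1 ∧ ‖t₀‖ < 1 ∧ c + s₀ • ((R : ℂ) • u) = z ∧
      c + t₀ • ((R : ℂ) • u) = w ∧ k • ((R : ℂ) • u) = w - z := by
  have hn : 0 < ‖w - z‖ := norm_pos_iff.2 (sub_ne_zero.2 hzw.symm)
  have hnC : (‖w - z‖ : ℂ) ≠ 0 := by exact_mod_cast hn.ne'
  set u : C2 := (‖w - z‖ : ℂ)⁻¹ • (w - z) with hu
  have hun : ‖u‖ = 1 := by
    rw [hu, norm_smul, norm_inv, Complex.norm_real, norm_norm, inv_mul_cancel₀ hn.ne']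
  have hwz : w - z = (‖w - z‖ : ℂ) • u := by rw [hu, smul_smul, mul_inv_cancel₀ hnC, one_smul]
  have huu : inner ℂ u u = (1 : ℂ) := by rw [inner_self_eq_norm_sq_to_K, hun]; simp
  set c : C2 := z - inner ℂ u z • u with hc
  have huc : inner ℂ u c = (0 : ℂ) := by
    rw [hc, inner_sub_right, inner_smul_right, huu, mul_one, sub_self]
  have hcu : inner ℂ c u = (0 : ℂ) := inner_eq_zero_symm.1 huc
  have hpyth : ∀ a : ℂ, ‖c + a • u‖ ^ 2 = ‖c‖ ^ 2 + ‖a‖ ^ 2 := by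
    intro a
    have h3 := norm_add_sq_eq_norm_sq_add_norm_sq_of_inner_eq_zero (𝕜 := ℂ)
      c (a • u) (by rw [inner_smul_right, hcu, mul_zero])
    rw [← pow_two, ← pow_two, ← pow_two] at h3
    rw [h3, norm_smul, hun, mul_one]
  have hzc : c + (inner ℂ u z : ℂ) • u = z := by rw [hc, sub_add_cancel]
  have hwc : c + (inner ℂ u z + (‖w - z‖ : ℂ)) • u = w := by
    rw [add_smul, ← add_assoc, hzc, ← hwz, add_sub_cancel]
  have hlt : ∀ {a : ℂ} {p : C2}, ‖p‖ < 1 → c + a • u = p → ‖a‖ ^ 2 < 1 - ‖c‖ ^ 2 := by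
    intro a p hp hap
    have h1 := hpyth a
    rw [hap] at h1
    nlinarith [norm_nonneg p]
  have hpos : 0 < 1 - ‖c‖ ^ 2 := (sq_nonneg _).trans_lt (hlt hz hzc)
  set R := √(1 - ‖c‖ ^ 2) with hR
  have hR0 : 0 < R := Real.sqrt_pos.2 hpos
  have hR2 : R ^ 2 = 1 - ‖c‖ ^ 2 := Real.sq_sqrt hpos.le
  have hRC : (R : ℂ) ≠ 0 := by exact_mod_cast hR0.ne'
  have hdiv : ∀ a : ℂ, (a / R) • ((R : ℂ) • u) = a • u := fun a => by
    rw [smul_smul, div_mul_cancel₀ a hRC]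
  have hdlt : ∀ {a : ℂ} {p : C2}, ‖p‖ < 1 → c + a • u = p → ‖a / R‖ < 1 := by
    intro a p hp hap
    have h1 := hlt hp hap
    rw [norm_div, Complex.norm_real, Real.norm_eq_abs, abs_of_pos hR0, div_lt_one hR0]
    exact lt_of_pow_lt_pow_left₀ 2 hR0.le (by rw [hR2]; exact h1)
  refine ⟨c, u, R, inner ℂ u z / R, (inner ℂ u z + (‖w - z‖ : ℂ)) / R, (‖w - z‖ : ℂ) / R, hun, hcu,
    hR0, by rw [hR2]; ring, hdlt hz hzc, hdlt hw hwc, ?_, ?_, ?_⟩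
  · rw [hdiv, hzc]
  · rw [hdiv, hwc]
  · rw [hdiv, ← hwz]

/-- A holomorphic map of the ball is uniformly continuous near compact discs. -/
theorem exists_uniform_coordMap {φ : unitBall → unitBall} (hφ : ContMDiff 𝓘(ℂ, C2) 𝓘(ℂ, C2) ω φ)
    {P : ℂ → C2} (hP : Continuous P) {ρ δ : ℝ} (hδ : 0 < δ) (hPm : ∀ t, ‖t‖ ≤ ρ → ‖P t‖ < 1) :
    ∃ η > 0, ∀ t, ‖t‖ ≤ ρ → ∀ y : C2, ‖y - P t‖ ≤ η →
      ‖coordMap φ y - coordMap φ (P t)‖ ≤ δ := by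
  have hK : IsCompact (P '' closedBall 0 ρ) := (isCompact_closedBall 0 ρ).image hP
  have hcont : ∀ x ∈ P '' closedBall 0 ρ, ContinuousAt (coordMap φ) x := by
    rintro _ ⟨t, ht, rfl⟩
    exact (differentiableOn_coordMap hφ).continuousOn.continuousAt
      (isOpen_ball.mem_nhds (mem_ball_zero_iff.2 (hPm t (mem_closedBall_zero_iff.1 ht))))
  have h1 := hK.uniformContinuousAt_of_continuousAt (coordMap φ) hcont (dist_mem_uniformity hδ)
  obtain ⟨η, hη, H⟩ := Metric.mem_uniformity_dist.1 h1
  refine ⟨η / 2, by positivity, fun t ht y hy => ?_⟩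
  have h2 : dist (P t) y < η := by rw [dist_comm, dist_eq_norm]; linarith
  have h3 := H h2 ⟨t, mem_closedBall_zero_iff.2 ht, rfl⟩
  have h4 : dist (coordMap φ (P t)) (coordMap φ y) < δ := h3
  rw [← dist_eq_norm, dist_comm]
  exact h4.le

/-- The strict inequality holds at the centre of a line through `z` and `φ z`, in the direction of
the line. -/
theorem exists_kobayashiMetric_lt_injective [CompactSpace (BallQuotient Γ)] :
    ∃ p : TangentBundle 𝓘(ℂ, C2) (BallQuotient Γ),
      kobayashiMetric C2 (BallQuotient Γ) p < injectiveKobayashiMetric C2 (BallQuotient Γ) p := by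
  obtain ⟨φ, hφ, hφ1⟩ := exists_ne_one_of_compactSpace (Γ := Γ)
  obtain ⟨A, hA⟩ := exists_isLift φ
  obtain ⟨z, hind⟩ := exists_cyclic_point hφ hφ1 hA
  set φ' : unitBall → unitBall := ⇑(φ : Equiv.Perm unitBall)
  have hfree : ∀ y, φ' y ≠ y := fun y hy => hφ1 (eq_one_of_smul_eq hφ hy)
  obtain ⟨c, u, R, s₀, t₀, k, hu, hcu, hR, hRc, hs₀, ht₀, hs, ht, hk⟩ :=
    exists_line_param (norm_coe_unitBall z) (norm_coe_unitBall (φ' z))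
      (fun h => hfree z (Subtype.ext h.symm))
  set v : C2 := (R : ℂ) • u with hv
  set P : ℂ → C2 := fun t => c + t • v with hP
  have hPn : ∀ t : ℂ, ‖t‖ < 1 → ‖P t‖ < 1 := by
    intro t ht
    have h3 := norm_add_sq_eq_norm_sq_add_norm_sq_of_inner_eq_zero (𝕜 := ℂ)
      c (t • v) (by rw [hv, inner_smul_right, inner_smul_right, hcu, mul_zero, mul_zero])
    rw [← pow_two, ← pow_two, ← pow_two] at h3
    have h4 : ‖t • v‖ = ‖t‖ * R := by
      rw [norm_smul, hv, norm_smul, hu, Complex.norm_real, Real.norm_eq_abs, abs_of_pos hR, mul_one]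
    rw [h4] at h3
    have h5 : ‖t‖ ^ 2 < 1 := by nlinarith [norm_nonneg t]
    have h6 : ‖t‖ ^ 2 * R ^ 2 < 1 * R ^ 2 := by gcongr
    have h7 : ‖P t‖ ^ 2 < 1 ^ 2 := by
      rw [hP]
      simp only
      rw [h3, mul_pow]
      linarith
    exact lt_of_pow_lt_pow_left₀ 2 zero_le_one h7
  have hPc : Continuous P := by fun_prop
  have hPd : Differentiable ℂ P := by fun_prop
  have hPmaps : Set.MapsTo P (ball 0 1) (ball 0 1) := fun t ht =>
    mem_ball_zero_iff.2 (hPn t (mem_ball_zero_iff.1 ht))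
  have hPderiv : ∀ t, deriv P t = v := fun t => by
    have : HasDerivAt P v t := by
      have h1 := ((hasDerivAt_id t).smul_const v).const_add c
      rwa [one_smul] at h1
    exact this.deriv
  -- The two crossing parameters lie, with a margin `ε`, in the disc of radius `ρ < 1`.
  set M := max ‖s₀‖ ‖t₀‖ with hM
  have hM1 : M < 1 := max_lt hs₀ ht₀
  set ε := (1 - M) / 2 with hε
  have hε0 : 0 < ε := by rw [hε]; linarith
  set ρ := M + ε with hρ
  have hρ1 : ρ < 1 := by rw [hρ, hε]; linarith
  have hball : ∀ {x₀ x : ℂ}, ‖x₀‖ ≤ M → x ∈ ball x₀ ε → ‖x‖ ≤ ρ := by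
    intro x₀ x hx₀ hx
    have h1 := norm_le_norm_add_norm_sub' x x₀
    have h2 : ‖x - x₀‖ < ε := by rw [← dist_eq_norm]; exact hx
    rw [hρ]
    linarith
  have hball1 : ∀ {x₀ : ℂ}, ‖x₀‖ ≤ M → ball x₀ ε ⊆ ball 0 1 := fun hx₀ x hx =>
    mem_ball_zero_iff.2 ((hball hx₀ hx).trans_lt hρ1)
  have hs₀M : ‖s₀‖ ≤ M := le_max_left _ _
  have ht₀M : ‖t₀‖ ≤ M := le_max_right _ _
  have hφd := differentiableOn_coordMap φ.2.1
  obtain ⟨δ₁, hδ₁, hcross⟩ := exists_crossing_of_close (a := fun s => coordMap φ' (P s)) (b := P)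
    (s₀ := s₀) (t₀ := t₀) hε0 ((hφd.comp hPd.differentiableOn hPmaps).mono (hball1 hs₀M))
    hPd.differentiableOn (by
      simp only [hP, hs, ht, coordMap_coe]) (fun x y hxy => by
      rw [hPderiv] at hxy
      exact transversal_of_cyclic hA hind hs hk hxy)
  obtain ⟨η₁, hη₁, hunif⟩ := exists_uniform_coordMap φ.2.1 hPc hδ₁
    (fun t ht => hPn t (ht.trans_lt hρ1))
  obtain ⟨δ, hδ, hext⟩ := exists_close_of_almost_extremal hu hcu hR hRc hρ1
    (lt_min hη₁ hδ₁)
  set F : ℂ → unitBall := fun t => toBall (P t) with hF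
  have hFd : ContMDiffOn 𝓘(ℂ, ℂ) 𝓘(ℂ, C2) ω F (ball 0 1) := by
    have hPs : ContMDiff 𝓘(ℂ, ℂ) 𝓘(ℂ, C2) ω P :=
      contMDiff_iff_contDiff.2 (contDiff_const.add (contDiff_id.smul contDiff_const))
    exact contMDiffOn_toBall.comp hPs.contMDiffOn hPmaps
  have hF0 : (F 0 : C2) = c := by
    rw [hF]
    simp only
    rw [coe_toBall (hPn 0 (by simp))]
    simp [hP]
  have hFderiv : deriv (fun t => (F t : C2)) 0 = v := by
    rw [← hPderiv 0]
    refine Filter.EventuallyEq.deriv_eq ?_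
    filter_upwards [isOpen_ball.mem_nhds (mem_ball_self (x := (0 : ℂ)) one_pos)] with t ht
    exact coe_toBall (hPn t (mem_ball_zero_iff.1 ht))
  refine ⟨tangentMap 𝓘(ℂ, ℂ) 𝓘(ℂ, C2) (proj Γ ∘ F) ⟨0, (1 : ℂ)⟩, ?_⟩
  have hkob : kobayashiMetric C2 (BallQuotient Γ)
      (tangentMap 𝓘(ℂ, ℂ) 𝓘(ℂ, C2) (proj Γ ∘ F) ⟨0, (1 : ℂ)⟩) ≤ 1 := by
    refine sInf_le ⟨proj Γ ∘ F, 1, one_pos, ⟨contMDiff_proj.comp_contMDiffOn hFd, ?_⟩, by simp⟩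
    rw [Complex.ofReal_one, one_smul]
  refine hkob.trans_lt ?_
  set δ' := min δ (1 / 2) with hδ'
  have hδ'0 : 0 < δ' := by positivity
  have hδ'1 : δ' ≤ 1 / 2 := min_le_right _ _
  have h1lt : (1 : ℝ≥0∞) < ENNReal.ofReal (1 / (1 - δ')) := by
    rw [← ENNReal.ofReal_one]
    refine (ENNReal.ofReal_lt_ofReal_iff (by apply one_div_pos.2; linarith)).2 ?_
    rw [lt_div_iff₀ (by linarith)]
    linarith
  refine h1lt.trans_le (le_sInf ?_)
  rintro _ ⟨f, r, hr, hf, hinj, rfl⟩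
  by_contra hlt
  push Not at hlt
  have hr1 : 1 - δ < r := by
    have h1 : 1 / r < 1 / (1 - δ') :=
      (ENNReal.ofReal_lt_ofReal_iff (by apply one_div_pos.2; linarith)).1 hlt
    have h2 := (one_div_lt_one_div hr (by linarith)).1 h1
    linarith [min_le_left δ (1 / 2)]
  obtain ⟨g, hgd, hg0, hgderiv, hgf⟩ := exists_holomorphic_lift hFd hf
  have hgmaps : Set.MapsTo (fun t => (g t : C2)) (ball 0 1) (ball 0 1) := fun t _ => (g t).2
  have hclose := hext r hr1 (fun t => (g t : C2)) hgd hgmaps (by simp only [hg0, hF0]) (by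
    rw [hgderiv, hFderiv, hv, smul_smul]
    push_cast
    rfl)
  have hclose' : ∀ t : ℂ, ‖t‖ ≤ ρ → ‖(g t : C2) - P t‖ ≤ min η₁ δ₁ := by
    intro t ht
    have h1 : P t = c + (R * t) • u := by rw [hP, hv, mul_comm, mul_smul]
    rw [h1]
    exact hclose t ht
  obtain ⟨s, hs, t, ht, hst⟩ := hcross (fun s => coordMap φ' (g s)) (fun t => (g t : C2))
    ((hφd.comp hgd hgmaps).mono (hball1 hs₀M)) (hgd.mono (hball1 ht₀M))
    (fun s hs => hunif s (hball hs₀M hs) _ ((hclose' s (hball hs₀M hs)).trans (min_le_left _ _)))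
    (fun t ht => (hclose' t (hball ht₀M ht)).trans (min_le_right _ _))
  rw [coordMap_coe] at hst
  have hgst : φ' (g s) = g t := Subtype.ext hst
  have hs1 := hball1 hs₀M hs
  have ht1 := hball1 ht₀M ht
  have hfst : f s = f t := by
    rw [← hgf s hs1, ← hgf t ht1, ← hgst]
    exact (proj_smul (⟨φ, hφ⟩ : Γ) (g s)).symm
  rw [hinj hs1 ht1 hfst] at hgst
  exact hfree _ hgst

end Kleinian

end BallQuotients

end

theorem theorem1p2 (Γ : Subgroup BallQuotients.holAut) [BallQuotients.IsKleinian Γ]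
    [CompactSpace (BallQuotients.BallQuotient Γ)] :
    BallQuotients.kobayashiMetric BallQuotients.C2 (BallQuotients.BallQuotient Γ) ≠
      BallQuotients.injectiveKobayashiMetric BallQuotients.C2 (BallQuotients.BallQuotient Γ) := by
  intro h
  obtain ⟨p, hp⟩ := BallQuotients.exists_kobayashiMetric_lt_injective (Γ := Γ)
  exact hp.ne (congrFun h p)
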